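/- Let $\delta>0$ and $0<D\le 2\delta$. Then there is a deterministic algorithm, depending only on $\delta$ and $D$ and using lights of $2$ colors, which solves Gathering for every number $n\ge 2$ of robots in the plane from every $D$-distant initial configuration (robots at different positions are at distance at least $D$; several robots may share a position), in the following model. Robots are anonymous points that all run this algorithm and have no memory except the color of their own light; all lights initially have one fixed color. Rounds are semi-synchronous (SSYNC): in each round an arbitrary set of robots is active, every robot being active in infinitely many rounds, and the active robots simultaneously look, compute and move. Each robot uses a local Cartesian coordinate system centered at its own position; units of length and directions of axes of different robots (or of one robot in different rounds) need not agree, but all robots agree on the clockwise orientation (chirality). A light is internal: an active robot sees the color of its own light and, in its local coordinates, the set of all occupied positions, but neither colors of other robots' lights nor how many robots occupy a position, and not whether other robots share its own position. From this and the value of $\delta$ in its own unit it computes a new color for its light and a destination. Movement is non-rigid: the robot moves straight towards its destination and an adversary may stop it before it gets there, but not before it has covered a distance of at least $\delta$. Solving Gathering means that, whatever the activations, the local coordinate systems and the stops chosen by the adversary, after finitely many rounds all robots are at a single location, not predefined, and remain there. -/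

import Mathlib

open scoped ComplexConjugate

namespace RobotsWithLights

/-- The axes of a local coordinate system of a robot; the plane `ℝ²` is identified with `ℂ`,
and the origin of the coordinate system is the current position of the robot.
The modulus of `factor` is the number of local length units in a global one, its argument gives
the direction of the local axes, and `mirrored` says whether the clockwise orientation of the
robot is opposite to that of the global coordinate system. -/
structure Frame where
  factor : ℂ
  factor_ne_zero : factor ≠ 0
  mirrored : Bool

namespace Frame

/-- Local coordinates of the point `q` for a robot located at `p`. -/
noncomputable def toLocal (F : Frame) (p q : ℂ) : ℂ :=
  F.factor * (if F.mirrored then conj (q - p) else q - p)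

/-- The point of the plane whose local coordinates are `w` for a robot located at `p`. -/
noncomputable def toGlobal (F : Frame) (p w : ℂ) : ℂ :=
  p + (if F.mirrored then conj (w / F.factor) else w / F.factor)

/-- The value, in local length units, of a length `ℓ` given in the global unit. -/
noncomputable def localLength (F : Frame) (ℓ : ℝ) : ℝ := ‖F.factor‖ * ℓ

theorem toGlobal_toLocal (F : Frame) (p q : ℂ) : F.toGlobal p (F.toLocal p q) = q := by
  have h := F.factor_ne_zero
  unfold toGlobal toLocal
  split_ifs <;> simp [h]

theorem toLocal_toGlobal (F : Frame) (p w : ℂ) : F.toLocal p (F.toGlobal p w) = w := by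
  have h := F.factor_ne_zero
  unfold toGlobal toLocal
  split_ifs <;> simp <;> field_simp

theorem dist_toLocal (F : Frame) (p q r : ℂ) :
    dist (F.toLocal p q) (F.toLocal p r) = F.localLength (dist q r) := by
  unfold toLocal localLength
  rw [dist_eq_norm, dist_eq_norm, ← mul_sub, norm_mul]
  split_ifs
  · rw [← map_sub, RCLike.norm_conj, sub_sub_sub_cancel_right]
  · rw [sub_sub_sub_cancel_right]

end Frame

/-- A deterministic algorithm for anonymous, uniform and oblivious robots with an internal light
of `k` colors which know the minimum move length.
All lights initially have the color `initialColor`. From the color of its own light, the minimum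
move length in its own length unit, and its snapshot (in its own coordinate system), an active
robot computes the new color of its light and its destination (in its own coordinate system).
The algorithm does not know the number of robots. -/
structure Algorithm (k : ℕ) where
  initialColor : Fin k
  compute : Fin k → ℝ → Set ℂ → Fin k × ℂ

/-- The positions (in the global coordinate system) and the lights of `n` robots. -/
structure Configuration (k n : ℕ) where
  pos : Fin n → ℂ
  light : Fin n → Fin k

variable {k n : ℕ}

/-- The snapshot of robot `i` with an internal light: the set of all occupied positions, in the
local coordinates of `i`. No colors of other robots are seen, no numbers of robots at a position
are seen, and robot `i` does not see whether other robots share its position `0`. -/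
def snapshot (C : Configuration k n) (F : Frame) (i : Fin n) : Set ℂ :=
  {w | ∃ j, w = F.toLocal (C.pos i) (C.pos j)}

/-- The color and the destination which robot `i` computes; the destination has been translated
to the global coordinate system. -/
noncomputable def decision (𝒜 : Algorithm k) (δ : ℝ) (C : Configuration k n) (F : Frame)
    (i : Fin n) : Fin k × ℂ :=
  let out := 𝒜.compute (C.light i) (F.localLength δ) (snapshot C F i)
  (out.1, F.toGlobal (C.pos i) out.2)

/-- Non-rigid movement from `p` to the destination `d` with minimum move length `δ`: it ends in
a point `q` of the line segment, which is `d` unless a distance of at least `δ` was covered. -/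
def NonRigidMove (δ : ℝ) (p d q : ℂ) : Prop :=
  q ∈ segment ℝ p d ∧ (q = d ∨ δ ≤ dist p q)

/-- One semi-synchronous round: the robots in `active` perform Look, Compute and Move
simultaneously, the other robots do nothing. -/
def Round (𝒜 : Algorithm k) (δ : ℝ) (F : Fin n → Frame) (active : Set (Fin n))
    (C C' : Configuration k n) : Prop :=
  ∀ i,
    (i ∈ active →
      C'.light i = (decision 𝒜 δ C (F i) i).1 ∧
      NonRigidMove δ (C.pos i) (decision 𝒜 δ C (F i) i).2 (C'.pos i)) ∧
    (i ∉ active → C'.light i = C.light i ∧ C'.pos i = C.pos i)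

/-- A fair scheduler activates every robot infinitely often. -/
def Fair (active : ℕ → Set (Fin n)) : Prop :=
  ∀ i t, ∃ t' ≥ t, i ∈ active t'

/-- All robots agree, at all times, on the clockwise orientation. -/
def AgreeOnChirality (F : ℕ → Fin n → Frame) : Prop :=
  ∀ t i t' i', (F t i).mirrored = (F t' i').mirrored

/-- `C` is an execution of `𝒜` by `n` robots under a fair SSYNC scheduler, with non-rigid movement
of known minimum length `δ` and with chirality. The scheduler, the coordinate systems
and the points where robots are stopped are arbitrary. -/
def IsExecution (𝒜 : Algorithm k) (δ : ℝ) (C : ℕ → Configuration k n) : Prop :=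
  (∀ i, (C 0).light i = 𝒜.initialColor) ∧
  ∃ (active : ℕ → Set (Fin n)) (F : ℕ → Fin n → Frame),
    Fair active ∧ AgreeOnChirality F ∧ ∀ t, Round 𝒜 δ (F t) (active t) (C t) (C (t + 1))

/-- Robots at different positions have distance at least `D`. -/
def Configuration.IsDistant (C : Configuration k n) (D : ℝ) : Prop :=
  ∀ i j, C.pos i ≠ C.pos j → D ≤ dist (C.pos i) (C.pos j)

/-- In finite time all robots are at a single location, where they remain. -/
def Gathers (C : ℕ → Configuration k n) : Prop :=
  ∃ (p : ℂ) (T : ℕ), ∀ t ≥ T, ∀ i, (C t).pos i = p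

end RobotsWithLights

/-! With `D = 80 * u`, every move that matters has length at most `22 * u`, hence at most `δ`, so
the adversary cannot interrupt it. The algorithm is built only from distances and smallest enclosing
discs, so it commutes with isometries and can be analysed in global coordinates
(`decision_gatheringAlgorithm`). The disc radius and the presence of a distance `20 * u` tell an
oblivious robot which phase it is in.

Contraction (`ContractState`): robots near the boundary of the disc step inwards by at most `u /
100`, with a common generic step length that never creates a distance `20 * u`, so no false marker
appears. The small step makes the radius land in `[99/100 * u, u)` when it first drops below `u`. It
does drop: once the radius has almost converged, `IsEnclosing.dist_sq_le` bounds the drift of the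
center, so each robot moves at most once more, whereas a boundary robot must move when activated.

Centering (`CenterState`): robots go to the center and take color 1, boundary robots only after the
inner ones, so that the disc stays fixed until then. Either all gather, or the radius stays in the
window and fewer robots have color 0, or the disc becomes smaller than `99/100 * u`. In the last
case all robots of color 1 sit at one point `c`.

Marker (`ReadyState`, `MarkerState`): the color-1 robots leave `c` for a far point `o` whose
distance to the nearest position other than `c` is exactly `20 * u`. Everyone else then joins `o`,
those at distance `20 * u` last, so that the marker stays recognizable. When only two positions
remain they look alike, and the color decides: 1 stays and 0 moves. Each phase terminates by the
fairness argument `exists_goal_of_progress`. -/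

namespace RobotsWithLights

/-! ### Smallest enclosing discs -/

/-- The disc with center `c` and radius `R` is a smallest disc that encloses `S`. -/
def IsEnclosing (S : Set ℂ) (c : ℂ) (R : ℝ) : Prop :=
  (∀ p ∈ S, dist p c ≤ R) ∧ ∀ z r, (∀ p ∈ S, dist p z ≤ r) → R ≤ r

theorem dist_midpoint_sq (p a b : ℂ) :
    dist p (midpoint ℝ a b) ^ 2 = (dist p a ^ 2 + dist p b ^ 2) / 2 - dist a b ^ 2 / 4 := by
  simp only [Complex.dist_eq, ← Complex.normSq_eq_norm_sq, Complex.normSq_apply,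
    midpoint_eq_smul_add]
  simp
  ring

theorem IsEnclosing.radius_nonneg {S : Set ℂ} {c : ℂ} {R : ℝ} (h : IsEnclosing S c R)
    (hS : S.Nonempty) : 0 ≤ R :=
  dist_nonneg.trans (h.1 _ hS.some_mem)

/-- By the median formula, points that are within `R` of `c` and within `r` of `z` are so close to
the midpoint of `c` and `z` that a large distance of `c` and `z` would contradict minimality of `R`.
For `r = R` this gives uniqueness; in general it bounds how far the center moves when the radius
shrinks. -/
theorem IsEnclosing.dist_sq_le {S : Set ℂ} {c z : ℂ} {R r : ℝ} (h : IsEnclosing S c R)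
    (hS : S.Nonempty) (hz : ∀ p ∈ S, dist p z ≤ r) : dist c z ^ 2 ≤ 2 * (r ^ 2 - R ^ 2) := by
  have hR := h.radius_nonneg hS
  have hr : 0 ≤ r := dist_nonneg.trans (hz _ hS.some_mem)
  set M := (R ^ 2 + r ^ 2) / 2 - dist c z ^ 2 / 4 with hM
  have key : ∀ p ∈ S, dist p (midpoint ℝ c z) ^ 2 ≤ M := by
    intro p hp
    rw [dist_midpoint_sq]
    have h1 : dist p c ^ 2 ≤ R ^ 2 := pow_le_pow_left₀ dist_nonneg (h.1 p hp) 2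
    have h2 : dist p z ^ 2 ≤ r ^ 2 := pow_le_pow_left₀ dist_nonneg (hz p hp) 2
    linarith
  have hM0 : 0 ≤ M := (sq_nonneg _).trans (key _ hS.some_mem)
  have h1 : R ≤ √M := h.2 (midpoint ℝ c z) _ fun p hp => Real.le_sqrt_of_sq_le (key p hp)
  have h2 : R ^ 2 ≤ M := by
    have := pow_le_pow_left₀ hR h1 2
    rwa [Real.sq_sqrt hM0] at this
  linarith

theorem IsEnclosing.unique {S : Set ℂ} {c c' : ℂ} {R R' : ℝ} (h : IsEnclosing S c R)
    (h' : IsEnclosing S c' R') (hS : S.Nonempty) : c = c' ∧ R = R' := by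
  have hR : R = R' := le_antisymm (h.2 _ _ h'.1) (h'.2 _ _ h.1)
  refine ⟨?_, hR⟩
  have := h.dist_sq_le hS h'.1
  rw [hR, sub_self, mul_zero] at this
  exact dist_eq_zero.1 (pow_eq_zero_iff two_ne_zero |>.1 (le_antisymm this (sq_nonneg _)))

theorem IsEnclosing.exists_le_dist {S : Set ℂ} {c z : ℂ} {R : ℝ} (h : IsEnclosing S c R)
    (hS : S.Nonempty) (hfin : S.Finite) : ∃ p ∈ S, R ≤ dist p z := by
  obtain ⟨p, hp, hmax⟩ := Set.exists_max_image S (fun p => dist p z) hfin hS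
  exact ⟨p, hp, h.2 z _ hmax⟩

theorem IsEnclosing.exists_dist_eq {S : Set ℂ} {c : ℂ} {R : ℝ} (h : IsEnclosing S c R)
    (hS : S.Nonempty) (hfin : S.Finite) : ∃ p ∈ S, dist p c = R := by
  obtain ⟨p, hp, hle⟩ := h.exists_le_dist (z := c) hS hfin
  exact ⟨p, hp, le_antisymm (h.1 p hp) hle⟩

/-- The largest distance from `z` to the points is the sup distance of `x` to a constant function;
it is continuous and coercive in `z`, so it attains its minimum. -/
theorem exists_isEnclosing_range {n : ℕ} [NeZero n] (x : Fin n → ℂ) :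
    ∃ c R, IsEnclosing (Set.range x) c R := by
  have hcont : Continuous fun z : ℂ => dist x (fun _ => z) := by fun_prop
  have hlim : Filter.Tendsto (fun z : ℂ => dist x (fun _ => z)) (Filter.cocompact ℂ) Filter.atTop := by
    refine Filter.tendsto_atTop_mono (f := fun z => dist z (x 0)) (fun z => ?_)
      (tendsto_dist_right_cocompact_atTop _)
    rw [dist_comm]
    exact dist_le_pi_dist x (fun _ => z) 0
  obtain ⟨c, hc⟩ := hcont.exists_forall_le hlim
  refine ⟨c, dist x fun _ => c, ?_, ?_⟩
  · rintro _ ⟨i, rfl⟩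
    exact dist_le_pi_dist x (fun _ => c) i
  · intro z r hz
    refine (hc z).trans ((dist_pi_le_iff (dist_nonneg.trans (hz _ ⟨0, rfl⟩))).2 fun i => hz _ ⟨i, rfl⟩)

theorem IsEnclosing.image {S : Set ℂ} {c : ℂ} {R : ℝ} (h : IsEnclosing S c R) (g : ℂ ≃ᵃⁱ[ℝ] ℂ) :
    IsEnclosing (g '' S) (g c) R := by
  refine ⟨?_, fun z r hz => h.2 (g.symm z) r fun p hp => ?_⟩
  · rintro _ ⟨p, hp, rfl⟩
    rw [g.dist_map]
    exact h.1 p hp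
  · rw [← g.dist_map, g.apply_symm_apply]
    exact hz _ ⟨p, hp, rfl⟩

/-- The smallest enclosing disc only depends on the points on its boundary. -/
theorem IsEnclosing.of_boundary {S T : Set ℂ} {c : ℂ} {R : ℝ} (h : IsEnclosing S c R)
    (hS : S.Nonempty) (hfin : S.Finite) (hT : ∀ p ∈ T, dist p c ≤ R)
    (hST : ∀ p ∈ S, dist p c = R → p ∈ T) : IsEnclosing T c R := by
  refine ⟨hT, fun z r hz => ?_⟩
  by_contra! hlt
  -- If `T` fitted into a smaller disc around `z`, moving the center slightly from `c` towards `z`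
  -- would bring all of `S` strictly inside radius `R`: boundary points by convexity of the
  -- distance, the others by continuity.
  have key : ∀ p ∈ S, ∀ᶠ x in nhdsWithin (0 : ℝ) (Set.Ioi 0),
      dist p (AffineMap.lineMap c z x) < R := by
    intro p hp
    rcases (h.1 p hp).lt_or_eq with hpc | hpc
    · have hc : Continuous fun x : ℝ => dist p (AffineMap.lineMap c z x) := by
        simp only [AffineMap.lineMap_apply]
        fun_prop
      have h0 : dist p (AffineMap.lineMap c z (0 : ℝ)) < R := by simpa using hpc
      exact nhdsWithin_le_nhds (hc.continuousAt.eventually_lt continuousAt_const h0)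
    · have h1 : Set.Ioo (0 : ℝ) 1 ∈ nhdsWithin (0 : ℝ) (Set.Ioi 0) :=
        Ioo_mem_nhdsGT one_pos
      filter_upwards [h1] with x hx
      have hpz := hz p (hST p hp hpc)
      have e : p - AffineMap.lineMap c z x = (1 - x) • (p - c) + x • (p - z) := by
        simp only [AffineMap.lineMap_apply, vsub_eq_sub, vadd_eq_add, Complex.real_smul]
        push_cast
        ring
      rw [dist_eq_norm, e]
      have h2 := norm_add_le ((1 - x) • (p - c)) (x • (p - z))
      rw [norm_smul, norm_smul, Real.norm_of_nonneg hx.1.le,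
        Real.norm_of_nonneg (sub_nonneg.2 hx.2.le), ← dist_eq_norm p, ← dist_eq_norm p, hpc] at h2
      nlinarith [hx.1, hx.2]
  obtain ⟨x, hx⟩ := ((Filter.eventually_all_finite hfin).2 key).exists
  obtain ⟨p, hp, hle⟩ := h.exists_le_dist (z := AffineMap.lineMap c z x) hS hfin
  exact absurd (hx p hp) (not_lt.2 hle)

/-- The center of the smallest enclosing disc of `S`. -/
noncomputable def discCenter (S : Set ℂ) : ℂ := Classical.epsilon fun c => ∃ R, IsEnclosing S c R

/-- The radius of the smallest enclosing disc of `S`. -/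
noncomputable def discRadius (S : Set ℂ) : ℝ := Classical.epsilon fun R => ∃ c, IsEnclosing S c R

theorem IsEnclosing.center_eq {S : Set ℂ} {c : ℂ} {R : ℝ} (h : IsEnclosing S c R)
    (hS : S.Nonempty) : discCenter S = c := by
  obtain ⟨R', h'⟩ := Classical.epsilon_spec (p := fun c => ∃ R, IsEnclosing S c R) ⟨c, R, h⟩
  exact (IsEnclosing.unique h' h hS).1

theorem IsEnclosing.radius_eq {S : Set ℂ} {c : ℂ} {R : ℝ} (h : IsEnclosing S c R)
    (hS : S.Nonempty) : discRadius S = R := by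
  obtain ⟨c', h'⟩ := Classical.epsilon_spec (p := fun R => ∃ c, IsEnclosing S c R) ⟨R, c, h⟩
  exact (IsEnclosing.unique h' h hS).2

theorem isEnclosing_range {n : ℕ} [NeZero n] (x : Fin n → ℂ) :
    IsEnclosing (Set.range x) (discCenter (Set.range x)) (discRadius (Set.range x)) := by
  obtain ⟨c, R, h⟩ := exists_isEnclosing_range x
  rwa [h.center_eq (Set.range_nonempty x), h.radius_eq (Set.range_nonempty x)]

/-! ### The algorithm

All lengths are multiples of a length `u`, which is small compared with the minimum distance of the
initial configuration. The colors are `0` (initially) and `1`. -/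

/-- The position after a robot at `p` has made a step of length `x * (u / 100)` towards the center
of the smallest enclosing disc of `S`; only robots near the boundary make a step. -/
noncomputable def contract (u : ℝ) (S : Set ℂ) (x : ℝ) (p : ℂ) : ℂ :=
  open Classical in
  if dist p (discCenter S) ≤ discRadius S - u / 400 then p
  else AffineMap.lineMap p (discCenter S) (x * (u / 100) / dist p (discCenter S))

/-- The factors `x` for which no partial contraction of `S` has two points at distance `20 * u`. -/
def genericFactors (u : ℝ) (S : Set ℂ) : Set ℝ :=
  {x | 1 / 2 ≤ x ∧ x ≤ 1 ∧ ∀ p ∈ S, ∀ q ∈ S,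
    dist (contract u S x p) (contract u S x q) ≠ 20 * u ∧ dist (contract u S x p) q ≠ 20 * u}

/-- The factor used by all robots which contract `S`. -/
noncomputable def genericFactor (u : ℝ) (S : Set ℂ) : ℝ :=
  Classical.epsilon fun x => x ∈ genericFactors u S

/-- The point at distance `x` from `p` in the direction from the center of the smallest enclosing
disc of `S` to `p`. -/
noncomputable def outward (S : Set ℂ) (p : ℂ) (x : ℝ) : ℂ :=
  AffineMap.lineMap (discCenter S) p (1 + x / dist p (discCenter S))

/-- The distance of the marker from the robots which create it. -/
noncomputable def markerDist (u : ℝ) (S : Set ℂ) (p : ℂ) : ℝ :=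
  Classical.epsilon fun x => 0 ≤ x ∧ Metric.infDist (outward S p x) (S \ {p}) = 20 * u

/-- The point `o` of `S` is a marker: the other points of `S` are close to each other, and far from
`o`, one of them at distance exactly `20 * u`. -/
def IsMarker (u : ℝ) (S : Set ℂ) (o : ℂ) : Prop :=
  o ∈ S ∧ (∃ k ∈ S, dist k o = 20 * u) ∧ (∀ k ∈ S, k ≠ o → 19 * u ≤ dist k o) ∧
    ∀ k ∈ S, ∀ l ∈ S, k ≠ o → l ≠ o → dist k l ≤ 2 * u

/-- A robot at `p` with color `k` has to move to the marker `o`. -/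
def JoinsMarker (u : ℝ) (k : Fin 2) (S : Set ℂ) (p o : ℂ) : Prop :=
  IsMarker u S o ∧ p ≠ o ∧ ((∀ q ∈ S, q = o ∨ q = p) → k = 0) ∧
    (dist p o = 20 * u → ∀ q ∈ S, q ≠ o → dist q o = 20 * u)

/-- If the smallest enclosing disc of `S` has radius less than `99 / 100 * u`, robots of color `0`
do not move, nor does a robot at the center of the disc. -/
def IsIdle (k : Fin 2) (S : Set ℂ) (p : ℂ) : Prop :=
  k = 0 ∨ p = discCenter S

/-- A robot at `p` does not move to the center of the smallest enclosing disc of `S` if it is there,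
or if it is on the boundary of the disc and other robots have to move first. -/
def IsWaiting (S : Set ℂ) (p : ℂ) : Prop :=
  p = discCenter S ∨ (dist p (discCenter S) = discRadius S ∧
    ∃ q ∈ S, q ≠ discCenter S ∧ dist q (discCenter S) ≠ discRadius S)

/-- The new color and the destination, in global coordinates, of a robot at `p` with color `k` if
`S` is the set of occupied positions. -/
noncomputable def robotStep (u : ℝ) (k : Fin 2) (S : Set ℂ) (p : ℂ) : Fin 2 × ℂ :=
  open Classical in
  if discRadius S < 99 / 100 * u then
    if IsIdle k S p then (k, p) else (1, outward S p (markerDist u S p))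
  else if discRadius S < u then
    if IsWaiting S p then (k, p) else (1, discCenter S)
  else if ∃ o, IsMarker u S o then
    if ∃ o, JoinsMarker u k S p o then (1, Classical.epsilon (JoinsMarker u k S p)) else (k, p)
  else (k, contract u S (genericFactor u S) p)

/-- The algorithm: a robot normalizes its length unit, so that its coordinates become an isometric
image of the global ones. -/
noncomputable def gatheringAlgorithm (δ u : ℝ) : Algorithm 2 where
  initialColor := 0
  compute k L W :=
    let out := robotStep u k ((fun w => ((δ / L : ℝ) : ℂ) * w) '' W) 0
    (out.1, out.2 / ((δ / L : ℝ) : ℂ))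

/-! ### Independence of the coordinate systems -/

theorem IsEnclosing.discCenter_image {S : Set ℂ} {c : ℂ} {R : ℝ} (h : IsEnclosing S c R)
    (hS : S.Nonempty) (g : ℂ ≃ᵃⁱ[ℝ] ℂ) : discCenter (g '' S) = g (discCenter S) := by
  rw [(h.image g).center_eq (hS.image g), h.center_eq hS]

theorem IsEnclosing.discRadius_image {S : Set ℂ} {c : ℂ} {R : ℝ} (h : IsEnclosing S c R)
    (hS : S.Nonempty) (g : ℂ ≃ᵃⁱ[ℝ] ℂ) : discRadius (g '' S) = discRadius S := by
  rw [(h.image g).radius_eq (hS.image g), h.radius_eq hS]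

theorem map_lineMap (g : ℂ ≃ᵃⁱ[ℝ] ℂ) (a b : ℂ) (x : ℝ) :
    g (AffineMap.lineMap a b x) = AffineMap.lineMap (g a) (g b) x :=
  AffineMap.apply_lineMap g.toAffineEquiv.toAffineMap a b x

theorem IsEnclosing.contract_image {S : Set ℂ} {c : ℂ} {R : ℝ} (h : IsEnclosing S c R)
    (hS : S.Nonempty) (g : ℂ ≃ᵃⁱ[ℝ] ℂ) (u x : ℝ) (p : ℂ) :
    contract u (g '' S) x (g p) = g (contract u S x p) := by
  unfold contract
  rw [h.discCenter_image hS, h.discRadius_image hS, g.dist_map, apply_ite g, map_lineMap]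

theorem IsEnclosing.genericFactor_image {S : Set ℂ} {c : ℂ} {R : ℝ} (h : IsEnclosing S c R)
    (hS : S.Nonempty) (g : ℂ ≃ᵃⁱ[ℝ] ℂ) (u : ℝ) :
    genericFactor u (g '' S) = genericFactor u S := by
  have : genericFactors u (g '' S) = genericFactors u S := by
    simp only [genericFactors, Set.forall_mem_image, h.contract_image hS, g.dist_map]
  rw [genericFactor, this, genericFactor]

theorem IsEnclosing.outward_image {S : Set ℂ} {c : ℂ} {R : ℝ} (h : IsEnclosing S c R)
    (hS : S.Nonempty) (g : ℂ ≃ᵃⁱ[ℝ] ℂ) (p : ℂ) (x : ℝ) :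
    outward (g '' S) (g p) x = g (outward S p x) := by
  rw [outward, outward, h.discCenter_image hS, map_lineMap, g.dist_map]

theorem IsEnclosing.markerDist_image {S : Set ℂ} {c : ℂ} {R : ℝ} (h : IsEnclosing S c R)
    (hS : S.Nonempty) (g : ℂ ≃ᵃⁱ[ℝ] ℂ) (u : ℝ) (p : ℂ) :
    markerDist u (g '' S) (g p) = markerDist u S p := by
  have e : g '' S \ {g p} = g '' (S \ {p}) := by
    rw [Set.image_sdiff g.injective, Set.image_singleton]
  simp only [markerDist, h.outward_image hS, e, Metric.infDist_image g.isometry]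

theorem isMarker_image (g : ℂ ≃ᵃⁱ[ℝ] ℂ) (u : ℝ) (S : Set ℂ) (o : ℂ) :
    IsMarker u (g '' S) (g o) ↔ IsMarker u S o := by
  simp only [IsMarker, Set.forall_mem_image, Set.exists_mem_image, g.dist_map, g.injective.ne_iff,
    g.injective.mem_set_image]

theorem joinsMarker_image (g : ℂ ≃ᵃⁱ[ℝ] ℂ) (u : ℝ) (k : Fin 2) (S : Set ℂ) (p o : ℂ) :
    JoinsMarker u k (g '' S) (g p) (g o) ↔ JoinsMarker u k S p o := by
  simp only [JoinsMarker, isMarker_image, Set.forall_mem_image, g.dist_map, g.injective.ne_iff,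
    g.injective.eq_iff]

/-- A robot away from two distinct markers would be within `2 * u` of one as seen from the other,
yet at least `19 * u` from it. -/
theorem JoinsMarker.unique {u : ℝ} (hu : 0 < u) {k : Fin 2} {S : Set ℂ} {p o o' : ℂ} (hp : p ∈ S)
    (h : JoinsMarker u k S p o) (h' : IsMarker u S o') (hpo' : p ≠ o') : o = o' := by
  by_contra hne
  have h1 := h.1.2.2.2 p hp o' h'.1 h.2.1 (Ne.symm hne)
  have h2 := h'.2.2.1 p hp hpo'
  linarith

theorem epsilon_joinsMarker {u : ℝ} (hu : 0 < u) {k : Fin 2} {S : Set ℂ} {p o : ℂ} (hp : p ∈ S)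
    (h : JoinsMarker u k S p o) : Classical.epsilon (JoinsMarker u k S p) = o :=
  have h' : JoinsMarker u k S p _ := Classical.epsilon_spec ⟨o, h⟩
  h'.unique hu hp h.1 h.2.1

/-- The scalars picked by `Classical.epsilon` agree because the isometry leaves their defining
predicates literally equal. A marker is a point, so there uniqueness is needed. -/
theorem IsEnclosing.robotStep_image {S : Set ℂ} {c : ℂ} {R : ℝ} (h : IsEnclosing S c R)
    {u : ℝ} (hu : 0 < u) (g : ℂ ≃ᵃⁱ[ℝ] ℂ) (k : Fin 2) {p : ℂ} (hp : p ∈ S) :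
    robotStep u k (g '' S) (g p) = ((robotStep u k S p).1, g (robotStep u k S p).2) := by
  have hS : S.Nonempty := ⟨p, hp⟩
  have e1 : (∃ o, IsMarker u (g '' S) o) ↔ ∃ o, IsMarker u S o := by
    rw [g.surjective.exists]
    simp only [isMarker_image]
  have e2 : (∃ o, JoinsMarker u k (g '' S) (g p) o) ↔ ∃ o, JoinsMarker u k S p o := by
    rw [g.surjective.exists]
    simp only [joinsMarker_image]
  have e3 : (∃ o, JoinsMarker u k S p o) → Classical.epsilon (JoinsMarker u k (g '' S) (g p)) =
      g (Classical.epsilon (JoinsMarker u k S p)) := by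
    rintro ⟨o, ho⟩
    rw [epsilon_joinsMarker hu hp ho, epsilon_joinsMarker hu (Set.mem_image_of_mem g hp)
      ((joinsMarker_image g u k S p o).2 ho)]
  have e4 : IsWaiting (g '' S) (g p) ↔ IsWaiting S p := by
    simp only [IsWaiting, h.discCenter_image hS, h.discRadius_image hS, g.dist_map,
      g.injective.eq_iff, Set.exists_mem_image, g.injective.ne_iff]
  have e5 : IsIdle k (g '' S) (g p) ↔ IsIdle k S p := by
    rw [IsIdle, h.discCenter_image hS, g.injective.eq_iff, IsIdle]
  unfold robotStep
  rw [propext e4, propext e5, propext e1, propext e2, h.discCenter_image hS, h.discRadius_image hS,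
    h.outward_image hS, h.markerDist_image hS,
    h.contract_image hS, h.genericFactor_image hS]
  split_ifs
  all_goals first | rfl | (rw [e3]; assumption)

/-- The isometry of the plane which a coordinate system becomes after normalizing its length
unit. -/
theorem Frame.exists_isometry (F : Frame) (p : ℂ) : ∃ g : ℂ ≃ᵃⁱ[ℝ] ℂ,
    ∀ q, g q = ((1 / ‖F.factor‖ : ℝ) : ℂ) * F.toLocal p q := by
  have hf : ‖F.factor‖ ≠ 0 := norm_ne_zero_iff.2 F.factor_ne_zero
  have hf' : ((1 / ‖F.factor‖ : ℝ) : ℂ) ≠ 0 := by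
    rw [Complex.ofReal_ne_zero]
    positivity
  have hiso : Isometry fun q => ((1 / ‖F.factor‖ : ℝ) : ℂ) * F.toLocal p q := by
    refine Isometry.of_dist_eq fun q r => ?_
    rw [dist_eq_norm, ← mul_sub, norm_mul, ← dist_eq_norm, F.dist_toLocal, Frame.localLength,
      Complex.norm_real, Real.norm_of_nonneg (by positivity)]
    field_simp
  refine ⟨(IsometryEquiv.mk' _ (fun w => F.toGlobal p (w / ((1 / ‖F.factor‖ : ℝ) : ℂ)))
    (fun w => ?_) hiso).toRealAffineIsometryEquiv, fun q => rfl⟩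
  rw [F.toLocal_toGlobal, mul_div_cancel₀ _ hf']

/-- The decision of a robot does not depend on its coordinate system. -/
theorem decision_gatheringAlgorithm {n : ℕ} {δ u : ℝ} (hδ : 0 < δ) (hu : 0 < u)
    (C : Configuration 2 n) (F : Frame) (i : Fin n) :
    decision (gatheringAlgorithm δ u) δ C F i =
      robotStep u (C.light i) (Set.range C.pos) (C.pos i) := by
  have : NeZero n := ⟨i.pos.ne'⟩
  obtain ⟨g, hg⟩ := F.exists_isometry (C.pos i)
  have hf : ‖F.factor‖ ≠ 0 := norm_ne_zero_iff.2 F.factor_ne_zero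
  -- Comparing the known `δ` with its local value recovers the global unit of length.
  have hL : δ / F.localLength δ = 1 / ‖F.factor‖ := by
    rw [Frame.localLength]
    field_simp
  have himage : (fun w => ((1 / ‖F.factor‖ : ℝ) : ℂ) * w) '' snapshot C F i =
      g '' Set.range C.pos := by
    ext w
    simp only [snapshot, Set.mem_image, Set.mem_ofPred_eq, Set.mem_range, exists_exists_eq_and,
      hg]
    constructor
    · rintro ⟨_, ⟨j, rfl⟩, rfl⟩
      exact ⟨j, rfl⟩
    · rintro ⟨j, rfl⟩
      exact ⟨_, ⟨j, rfl⟩, rfl⟩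
  have h0 : g (C.pos i) = 0 := by
    rw [hg]
    simp [Frame.toLocal]
  have hf' : ((1 / ‖F.factor‖ : ℝ) : ℂ) ≠ 0 := by
    rw [Complex.ofReal_ne_zero]
    positivity
  simp only [decision, gatheringAlgorithm, hL, himage]
  rw [← h0, (isEnclosing_range C.pos).robotStep_image hu g _ ⟨i, rfl⟩]
  simp only [hg]
  rw [mul_div_cancel_left₀ _ hf', F.toGlobal_toLocal]

/-- A round in which the algorithm only makes moves of length at most `δ`, which are rigid. -/
theorem Round.apply {n : ℕ} {δ u : ℝ} (hδ : 0 < δ) (hu : 0 < u) {F : Fin n → Frame}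
    {active : Set (Fin n)} {C C' : Configuration 2 n}
    (h : Round (gatheringAlgorithm δ u) δ F active C C') {i : Fin n} (hi : i ∈ active)
    {k : Fin 2} {d : ℂ} (hd : robotStep u (C.light i) (Set.range C.pos) (C.pos i) = (k, d))
    (hle : dist (C.pos i) d ≤ δ) : C'.light i = k ∧ C'.pos i = d := by
  obtain ⟨h1, h2, h3⟩ := (h i).1 hi
  rw [decision_gatheringAlgorithm hδ hu, hd] at h1 h2 h3
  refine ⟨h1, h3.elim id fun hge => ?_⟩
  -- A stop after at least `δ` on a segment of length at most `δ` can only be at its end.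
  have h4 := dist_add_dist_of_mem_segment h2
  exact dist_le_zero.1 (by linarith)

/-! ### Rounds and progress -/

/-- A round in which all moves of length at most `δ` are rigid, without local coordinates. -/
def RigidRound {n : ℕ} (δ u : ℝ) (active : Set (Fin n)) (C C' : Configuration 2 n) : Prop :=
  ∀ i, (i ∈ active → ∀ k d, robotStep u (C.light i) (Set.range C.pos) (C.pos i) = (k, d) →
      dist (C.pos i) d ≤ δ → C'.light i = k ∧ C'.pos i = d) ∧
    (i ∉ active → C'.light i = C.light i ∧ C'.pos i = C.pos i)

theorem Round.rigidRound {n : ℕ} {δ u : ℝ} (hδ : 0 < δ) (hu : 0 < u) {F : Fin n → Frame}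
    {active : Set (Fin n)} {C C' : Configuration 2 n}
    (h : Round (gatheringAlgorithm δ u) δ F active C C') : RigidRound δ u active C C' :=
  fun i => ⟨fun hi _ _ hd hle => h.apply hδ hu hi hd hle, (h i).2⟩

theorem Configuration.ext_of_forall {k n : ℕ} {C C' : Configuration k n}
    (h : ∀ i, C'.light i = C.light i ∧ C'.pos i = C.pos i) : C' = C := by
  cases C
  cases C'
  simp only [Configuration.mk.injEq]
  exact ⟨funext fun i => (h i).2, funext fun i => (h i).1⟩

/-- All robots are at the same position. -/
def IsGathered {k n : ℕ} (C : Configuration k n) : Prop :=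
  ∃ p, ∀ i, C.pos i = p

/-- A goal is reached if, until then, each change of the configuration decreases a measure, and if
in each configuration there is a robot whose activation changes it. -/
theorem exists_goal_of_progress {k n : ℕ} {active : ℕ → Set (Fin n)} (hfair : Fair active)
    {C : ℕ → Configuration k n} {Inv Goal : Configuration k n → Prop} (m : Configuration k n → ℕ)
    (step : ∀ A, Inv A → ∃ i, ∀ t, C t = A → Goal (C (t + 1)) ∨ Inv (C (t + 1)) ∧
      (m (C (t + 1)) < m A ∨ C (t + 1) = A ∧ i ∉ active t))
    {t₀ : ℕ} (h₀ : Inv (C t₀)) : ∃ t ≥ t₀, Goal (C t) := by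
  induction hm : m (C t₀) using Nat.strong_induction_on generalizing t₀ with
  | _ m₀ ih =>
    by_contra! hno
    obtain ⟨i, hi⟩ := step _ h₀
    obtain ⟨t', ht', hact⟩ := hfair i t₀
    have hnoless : ∀ t ≥ t₀, Inv (C t) → ¬ m (C t) < m (C t₀) := by
      intro t ht hinv hlt
      obtain ⟨s, hs, hgoal⟩ := ih _ (hm ▸ hlt) hinv rfl
      exact hno s (ht.trans hs) hgoal
    have hconst : ∀ t ≥ t₀, C t = C t₀ ∧ Inv (C t) := by
      intro t ht
      induction t, ht using Nat.le_induction with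
      | base => exact ⟨rfl, h₀⟩
      | succ t ht IH =>
        rcases hi t IH.1 with h | ⟨h, h' | h'⟩
        · exact absurd h (hno _ (by omega))
        · exact absurd h' (hnoless _ (by omega) h)
        · exact ⟨h'.1, h⟩
    rcases hi t' (hconst t' ht').1 with h | ⟨h, h' | h'⟩
    · exact hno _ (by omega) h
    · exact hnoless _ (by omega) h h'
    · exact h'.2 hact

theorem IsEnclosing.dist_le {S : Set ℂ} {c p q : ℂ} {R : ℝ} (h : IsEnclosing S c R) (hp : p ∈ S)
    (hq : q ∈ S) : dist p q ≤ 2 * R := by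
  have := dist_triangle_right p q c
  linarith [h.1 p hp, h.1 q hq]

/-- The disc is a single point and each robot is at its center, hence idle whatever its color. -/
theorem IsGathered.round {n : ℕ} {δ u : ℝ} (hδ : 0 < δ) (hu : 0 < u) {active : Set (Fin n)}
    {C C' : Configuration 2 n} (h : RigidRound δ u active C C') {p : ℂ} (hC : ∀ i, C.pos i = p)
    (i : Fin n) : C'.pos i = p := by
  have : NeZero n := ⟨i.pos.ne'⟩
  by_cases hi : i ∈ active
  · have hS : Set.range C.pos = {p} := by
      rw [show C.pos = fun _ => p from funext hC, Set.range_const]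
    have henc : IsEnclosing (Set.range C.pos) p 0 := by
      rw [hS]
      refine ⟨by simp, fun z r hz => dist_nonneg.trans (hz p rfl)⟩
    have hne := Set.range_nonempty C.pos
    have hd : robotStep u (C.light i) (Set.range C.pos) (C.pos i) = (C.light i, p) := by
      rw [robotStep, henc.radius_eq hne, if_pos (by positivity),
        if_pos (show IsIdle _ _ _ from Or.inr (by rw [henc.center_eq hne, hC])), hC]
    exact ((h i).1 hi _ _ hd (by rw [hC, dist_self]; exact hδ.le)).2
  · rw [((h i).2 hi).2, hC]

/-! ### Gathering at a marker -/

/-- The point `o` is a marker of the set of positions, and colors are such that all robots will move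
to `o`. -/
structure MarkerState {n : ℕ} (u : ℝ) (o : ℂ) (C : Configuration 2 n) : Prop where
  at_marker : ∃ i, C.pos i = o
  at_dist : ∃ i, dist (C.pos i) o = 20 * u
  light_marker : ∀ i, C.pos i = o → C.light i = 1
  light_dist : ∀ i, dist (C.pos i) o = 20 * u → C.light i = 0
  far : ∀ i, C.pos i ≠ o → 19 * u ≤ dist (C.pos i) o
  close : ∀ i j, C.pos i ≠ o → C.pos j ≠ o → dist (C.pos i) (C.pos j) ≤ 2 * u

/-- The robot `i` goes to the marker `o` when it becomes active. -/
def CanJoin {n : ℕ} (u : ℝ) (o : ℂ) (C : Configuration 2 n) (i : Fin n) : Prop :=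
  C.pos i ≠ o ∧ (dist (C.pos i) o = 20 * u → ∀ j, C.pos j ≠ o → dist (C.pos j) o = 20 * u)

namespace MarkerState

variable {n : ℕ} {δ u : ℝ} {o : ℂ} {C C' : Configuration 2 n}

theorem isMarker (h : MarkerState u o C) : IsMarker u (Set.range C.pos) o := by
  refine ⟨h.at_marker, ?_, ?_, ?_⟩
  · obtain ⟨i, hi⟩ := h.at_dist
    exact ⟨_, ⟨i, rfl⟩, hi⟩
  · rintro _ ⟨i, rfl⟩
    exact h.far i
  · rintro _ ⟨i, rfl⟩ _ ⟨j, rfl⟩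
    exact h.close i j

theorem le_discRadius (hu : 0 < u) (h : MarkerState u o C) : u ≤ discRadius (Set.range C.pos) := by
  obtain ⟨i, hi⟩ := h.at_dist
  have : NeZero n := ⟨i.pos.ne'⟩
  have := (isEnclosing_range C.pos).dist_le ⟨i, rfl⟩ h.at_marker
  linarith

/-- If only two positions are occupied, the robot's own one must be at distance `20 * u` from `o`,
where all lights are 0. -/
theorem joinsMarker (hu : 0 < u) (h : MarkerState u o C) {i : Fin n} (hi : CanJoin u o C i) :
    JoinsMarker u (C.light i) (Set.range C.pos) (C.pos i) o := by
  refine ⟨h.isMarker, hi.1, fun hall => ?_, fun hd => ?_⟩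
  · obtain ⟨j, hj⟩ := h.at_dist
    have hjo : C.pos j ≠ o := by
      intro e
      rw [e, dist_self] at hj
      linarith
    have hji := (hall _ ⟨j, rfl⟩).resolve_left hjo
    exact h.light_dist i (hji ▸ hj)
  · rintro _ ⟨j, rfl⟩
    exact hi.2 hd j

/-- A robot at `o` can see another marker only if just two positions are occupied, and then its
color 1 holds it back. A robot elsewhere has no candidate but `o`. -/
theorem not_joinsMarker (hu : 0 < u) (h : MarkerState u o C) {i : Fin n} (hi : ¬ CanJoin u o C i) :
    ¬ ∃ o', JoinsMarker u (C.light i) (Set.range C.pos) (C.pos i) o' := by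
  rintro ⟨o', ho'⟩
  by_cases hio : C.pos i = o
  · have hall : ∀ q ∈ Set.range C.pos, q = o' ∨ q = C.pos i := by
      intro q hq
      by_contra! hne
      have h1 := ho'.1.2.2.2 q hq _ ⟨i, rfl⟩ hne.1 ho'.2.1
      have h2 := h.isMarker.2.2.1 q hq (hio ▸ hne.2)
      rw [hio] at h1
      linarith
    have := ho'.2.2.1 hall
    rw [h.light_marker i hio] at this
    exact one_ne_zero this
  · have e := ho'.unique hu (Set.mem_range_self i) h.isMarker hio
    subst e
    exact hi ⟨hio, fun hd j => ho'.2.2.2 hd _ ⟨j, rfl⟩⟩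

theorem dist_le (hu : 0 < u) (h : MarkerState u o C) (i : Fin n) : dist (C.pos i) o ≤ 22 * u := by
  by_cases hio : C.pos i = o
  · rw [hio, dist_self]
    positivity
  · obtain ⟨j, hj⟩ := h.at_dist
    have hjo : C.pos j ≠ o := by
      intro e
      rw [e, dist_self] at hj
      linarith
    linarith [dist_triangle (C.pos i) (C.pos j) o, h.close i j hio hjo]

theorem round (hu : 0 < u) (hδ : 40 * u ≤ δ) {active : Set (Fin n)} (h : MarkerState u o C)
    (hr : RigidRound δ u active C C') (i : Fin n) :
    (i ∈ active ∧ CanJoin u o C i ∧ C'.light i = 1 ∧ C'.pos i = o) ∨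
      ((i ∉ active ∨ ¬ CanJoin u o C i) ∧ C'.light i = C.light i ∧ C'.pos i = C.pos i) := by
  by_cases hact : i ∈ active
  swap
  · exact Or.inr ⟨Or.inl hact, (hr i).2 hact⟩
  have hR := h.le_discRadius hu
  by_cases hi : CanJoin u o C i
  · have hj := h.joinsMarker hu hi
    have hd : robotStep u (C.light i) (Set.range C.pos) (C.pos i) = (1, o) := by
      rw [robotStep, if_neg (by linarith), if_neg (by linarith), if_pos ⟨o, h.isMarker⟩,
        if_pos ⟨o, hj⟩, epsilon_joinsMarker hu (Set.mem_range_self i) hj]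
    exact Or.inl ⟨hact, hi, (hr i).1 hact _ _ hd ((h.dist_le hu i).trans (by linarith))⟩
  · have hd : robotStep u (C.light i) (Set.range C.pos) (C.pos i) = (C.light i, C.pos i) := by
      rw [robotStep, if_neg (by linarith), if_neg (by linarith), if_pos ⟨o, h.isMarker⟩,
        if_neg (h.not_joinsMarker hu hi)]
    exact Or.inr ⟨Or.inr hi, (hr i).1 hact _ _ hd (by rw [dist_self]; linarith)⟩

theorem exists_canJoin (hu : 0 < u) (h : MarkerState u o C) : ∃ i, CanJoin u o C i := by
  by_cases hall : ∀ j, C.pos j ≠ o → dist (C.pos j) o = 20 * u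
  · obtain ⟨i, hi⟩ := h.at_dist
    refine ⟨i, fun e => ?_, fun _ => hall⟩
    rw [e, dist_self] at hi
    linarith
  · push Not at hall
    obtain ⟨i, hi, hd⟩ := hall
    exact ⟨i, hi, fun e => absurd e hd⟩

theorem next (hu : 0 < u) (hδ : 40 * u ≤ δ) {active : Set (Fin n)} (h : MarkerState u o C)
    (hr : RigidRound δ u active C C') : IsGathered C' ∨ MarkerState u o C' := by
  by_cases hg : ∀ i, C'.pos i = o
  · exact Or.inl ⟨o, hg⟩
  push Not at hg
  obtain ⟨i₀, hi₀⟩ := hg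
  have hstep := h.round hu hδ hr
  have hstay : ∀ i, C'.pos i ≠ o →
      C'.light i = C.light i ∧ C'.pos i = C.pos i := by
    intro i hi
    rcases hstep i with h' | h'
    · exact absurd h'.2.2.2 hi
    · exact h'.2
  have hto : ∀ i, C.pos i = o → C'.light i = 1 ∧ C'.pos i = o := by
    intro i hi
    rcases hstep i with h' | h'
    · exact h'.2.2
    · exact ⟨h'.2.1.trans (h.light_marker i hi), h'.2.2.trans hi⟩
  have hne : ∀ i, dist (C'.pos i) o = 20 * u → C'.pos i ≠ o := by
    intro i hi e
    rw [e, dist_self] at hi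
    linarith
  refine Or.inr ⟨?_, ?_, ?_, ?_, ?_, ?_⟩
  · obtain ⟨i, hi⟩ := h.at_marker
    exact ⟨i, (hto i hi).2⟩
  -- Robots at distance `20 * u` stay until no other kind is left outside `o`; from then on, any
  -- robot still outside is a witness.
  · by_cases hall : ∀ j, C.pos j ≠ o → dist (C.pos j) o = 20 * u
    · have e := (hstay i₀ hi₀).2
      exact ⟨i₀, by rw [e]; exact hall i₀ (e ▸ hi₀)⟩
    · obtain ⟨i, hi⟩ := h.at_dist
      refine ⟨i, ?_⟩
      rcases hstep i with h' | h'
      · exact absurd (h'.2.1.2 hi) hall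
      · rw [h'.2.2, hi]
  · intro i hi
    rcases hstep i with h' | h'
    · exact h'.2.2.1
    · rw [h'.2.1]
      exact h.light_marker i (h'.2.2 ▸ hi)
  · intro i hi
    obtain ⟨h1, h2⟩ := hstay i (hne i hi)
    rw [h1]
    exact h.light_dist i (h2 ▸ hi)
  · intro i hi
    have e := (hstay i hi).2
    rw [e] at hi ⊢
    exact h.far i hi
  · intro i j hi hj
    have e := (hstay i hi).2
    have e' := (hstay j hj).2
    rw [e] at hi
    rw [e'] at hj
    rw [e, e']
    exact h.close i j hi hj

/-- Robots with a marker gather. -/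
theorem exists_gathered (hu : 0 < u) (hδ : 40 * u ≤ δ) {active : ℕ → Set (Fin n)}
    (hfair : Fair active) {C : ℕ → Configuration 2 n}
    (hr : ∀ t, RigidRound δ u (active t) (C t) (C (t + 1))) {t₀ : ℕ} (h : MarkerState u o (C t₀)) :
    ∃ t ≥ t₀, IsGathered (C t) := by
  refine exists_goal_of_progress hfair (fun A => {i | A.pos i ≠ o}.ncard)
    (Inv := MarkerState u o) (fun A hA => ?_) h
  obtain ⟨i, hi⟩ := hA.exists_canJoin hu
  refine ⟨i, ?_⟩
  rintro t rfl
  rcases hA.next hu hδ (hr t) with hg | hm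
  · exact Or.inl hg
  refine Or.inr ⟨hm, ?_⟩
  have hstep := hA.round hu hδ (hr t)
  by_cases hmove : ∃ j ∈ active t, CanJoin u o (C t) j
  · obtain ⟨j, hj, hcj⟩ := hmove
    left
    refine Set.ncard_lt_ncard ⟨fun l hl => ?_, fun hsub => ?_⟩ (Set.toFinite _)
    · rcases hstep l with h' | h'
      · exact absurd h'.2.2.2 hl
      · exact fun e => hl (h'.2.2.trans e)
    · rcases hstep j with h' | h'
      · exact hsub hcj.1 h'.2.2.2
      · exact h'.1.elim (fun h => h hj) fun h => h hcj
  · push Not at hmove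
    right
    refine ⟨Configuration.ext_of_forall fun j => ?_, fun hact => hmove i hact hi⟩
    rcases hstep j with h' | h'
    · exact absurd h'.2.1 (hmove j h'.1)
    · exact h'.2

end MarkerState

/-! ### Creating a marker -/

theorem dist_sq_lineMap_one_add (p a b : ℂ) (x : ℝ) :
    dist p (AffineMap.lineMap a b (1 + x)) ^ 2 =
      (1 + x) * dist p b ^ 2 - x * dist p a ^ 2 + x * (1 + x) * dist a b ^ 2 := by
  simp only [Complex.dist_eq, ← Complex.normSq_eq_norm_sq, Complex.normSq_apply,
    AffineMap.lineMap_apply, vsub_eq_sub, vadd_eq_add, Complex.real_smul]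
  simp
  ring

/-- The robots of color `1` are at `c`; the others are there or on a circle around `c`, and have a
smallest enclosing disc of smaller radius. -/
structure ReadyState {n : ℕ} (u : ℝ) (c : ℂ) (r : ℝ) (C : Configuration 2 n) : Prop where
  discRadius_lt : discRadius (Set.range C.pos) < 99 / 100 * u
  le_radius : 99 / 100 * u ≤ r
  radius_lt : r < u
  exists_light : ∃ i, C.light i = 1
  pos_eq : ∀ i, C.light i = 1 → C.pos i = c
  dist_eq : ∀ i, C.pos i ≠ c → dist (C.pos i) c = r
  exists_ne : ∃ i, C.pos i ≠ c

namespace ReadyState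

variable {n : ℕ} {δ u r : ℝ} {c : ℂ} {C C' : Configuration 2 n}

/-- Some robot is at distance `r` from `c`, more than the disc radius. Hence the ray from the disc
center through `c` is well defined. -/
theorem center_ne (h : ReadyState u c r C) : discCenter (Set.range C.pos) ≠ c := by
  intro e
  obtain ⟨i, hi⟩ := h.exists_ne
  have : NeZero n := ⟨i.pos.ne'⟩
  have h1 := (isEnclosing_range C.pos).1 _ ⟨i, rfl⟩
  rw [e, h.dist_eq i hi] at h1
  linarith [h.discRadius_lt, h.le_radius]

theorem dist_outward (h : ReadyState u c r C) {x : ℝ} (hx : 0 ≤ x) :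
    dist (outward (Set.range C.pos) c x) c = x := by
  have hd : 0 < dist c (discCenter (Set.range C.pos)) := dist_pos.2 h.center_ne.symm
  rw [outward, dist_lineMap_right, sub_add_cancel_left, norm_neg, Real.norm_of_nonneg (by positivity),
    dist_comm _ c, div_mul_cancel₀ _ hd.ne']

/-- A position on the circle is no farther from the disc center than from `c`, so the angle at `c`
between it and the outward ray is obtuse and the squared lengths at least add up. -/
theorem le_dist_outward (h : ReadyState u c r C) {x : ℝ} (hx : 0 ≤ x) {i : Fin n}
    (hi : C.pos i ≠ c) :
    r ^ 2 + x ^ 2 ≤ dist (C.pos i) (outward (Set.range C.pos) c x) ^ 2 := by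
  have : NeZero n := ⟨i.pos.ne'⟩
  have hu : 0 < u := by linarith [h.le_radius, h.radius_lt]
  have hd : 0 < dist c (discCenter (Set.range C.pos)) := dist_pos.2 h.center_ne.symm
  rw [outward, dist_sq_lineMap_one_add, h.dist_eq i hi, dist_comm _ c]
  set d := dist c (discCenter (Set.range C.pos))
  have h1 := (isEnclosing_range C.pos).1 _ ⟨i, rfl⟩
  have h2 : dist (C.pos i) (discCenter (Set.range C.pos)) ^ 2 ≤ r ^ 2 :=
    pow_le_pow_left₀ dist_nonneg (by linarith [h.discRadius_lt, h.le_radius]) 2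
  have h3 : 0 ≤ x / d := by positivity
  have h4 : x ^ 2 = (x / d) ^ 2 * d ^ 2 := by
    field_simp
  rw [h4]
  nlinarith [mul_nonneg h3 (sub_nonneg.2 h2), mul_nonneg h3 (sq_nonneg d)]

/-- Intermediate values: the distance to the other positions is at most `r < u` at the start of the
ray and more than `20 * u` after `21 * u`. -/
theorem exists_markerDist (h : ReadyState u c r C) : ∃ x, 0 ≤ x ∧
    Metric.infDist (outward (Set.range C.pos) c x) (Set.range C.pos \ {c}) = 20 * u := by
  obtain ⟨i, hi⟩ := h.exists_ne
  have hu : 0 < u := by linarith [h.le_radius, h.radius_lt]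
  have hmem : C.pos i ∈ Set.range C.pos \ {c} := ⟨⟨i, rfl⟩, hi⟩
  have hcont : Continuous fun x : ℝ =>
      Metric.infDist (outward (Set.range C.pos) c x) (Set.range C.pos \ {c}) := by
    have : Continuous fun x : ℝ => outward (Set.range C.pos) c x := by
      simp only [outward, AffineMap.lineMap_apply]
      fun_prop
    exact (Metric.continuous_infDist_pt _).comp this
  have h0 : Metric.infDist (outward (Set.range C.pos) c 0) (Set.range C.pos \ {c}) ≤ 20 * u := by
    refine (Metric.infDist_le_dist_of_mem hmem).trans ?_
    have : outward (Set.range C.pos) c 0 = c := dist_eq_zero.1 (h.dist_outward le_rfl)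
    rw [this, dist_comm, h.dist_eq i hi]
    linarith [h.radius_lt]
  have h1 : 20 * u ≤
      Metric.infDist (outward (Set.range C.pos) c (21 * u)) (Set.range C.pos \ {c}) := by
    rw [Metric.le_infDist ⟨_, hmem⟩]
    rintro _ ⟨⟨j, rfl⟩, hj⟩
    have h2 := h.dist_outward (x := 21 * u) (by positivity)
    have h3 := dist_triangle (outward (Set.range C.pos) c (21 * u)) (C.pos j) c
    rw [h.dist_eq j hj] at h3
    linarith [h.radius_lt]
  obtain ⟨x, hx, hfx⟩ := intermediate_value_Icc (by positivity : (0 : ℝ) ≤ 21 * u)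
    hcont.continuousOn ⟨h0, h1⟩
  exact ⟨x, hx.1, hfx⟩

/-- Nothing depends on which color-1 robots are activated: those left behind at `c` merely become
robots that still have to join `o`. -/
theorem next (hδ : 40 * u ≤ δ) {active : Set (Fin n)} (h : ReadyState u c r C)
    (hr : RigidRound δ u active C C') {i : Fin n} (hact : i ∈ active) (hlight : C.light i = 1) :
    ∃ o, MarkerState u o C' := by
  have hu : 0 < u := by linarith [h.le_radius, h.radius_lt]
  have : NeZero n := ⟨i.pos.ne'⟩
  have henc := isEnclosing_range C.pos
  set S := Set.range C.pos with hS
  obtain ⟨ht0, htd⟩ : 0 ≤ markerDist u S c ∧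
      Metric.infDist (outward S c (markerDist u S c)) (S \ {c}) = 20 * u :=
    Classical.epsilon_spec h.exists_markerDist
  set x := markerDist u S c with hx
  set o := outward S c x with ho
  have hoc : dist o c = x := h.dist_outward ht0
  have hge : ∀ j, C.pos j ≠ c → 20 * u ≤ dist (C.pos j) o := by
    intro j hj
    rw [dist_comm, ← htd]
    exact Metric.infDist_le_dist_of_mem ⟨⟨j, rfl⟩, hj⟩
  obtain ⟨j₀, hj₀, hj₀d⟩ : ∃ j, C.pos j ≠ c ∧ dist (C.pos j) o = 20 * u := by
    have hfin : (S \ {c}).Finite := (Set.finite_range C.pos).sdiff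
    obtain ⟨k, hk⟩ := h.exists_ne
    obtain ⟨_, ⟨⟨j, rfl⟩, hj⟩, e⟩ := hfin.isCompact.exists_infDist_eq_dist ⟨_, ⟨k, rfl⟩, hk⟩ o
    exact ⟨j, hj, by rw [dist_comm, ← e, htd]⟩
  -- The strict inequality keeps `c` off distance `20 * u`, so that only robots of color 0 are at
  -- that distance.
  have hxlt : x < 20 * u := by
    have h1 := h.le_dist_outward ht0 hj₀
    rw [← hS, ← ho, hj₀d] at h1
    have hr0 : 0 < r := by linarith [h.le_radius]
    exact lt_of_pow_lt_pow_left₀ 2 (by positivity) (by nlinarith)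
  have hxge : 19 * u ≤ x := by
    have h1 := dist_triangle (C.pos j₀) c o
    rw [hj₀d, h.dist_eq _ hj₀, dist_comm c, hoc] at h1
    linarith [h.radius_lt]
  have hstep : ∀ j, (j ∈ active ∧ C.light j = 1 ∧ C'.light j = 1 ∧ C'.pos j = o) ∨
      ((j ∉ active ∨ C.light j = 0) ∧ C'.light j = C.light j ∧ C'.pos j = C.pos j) := by
    intro j
    by_cases hj : j ∈ active
    swap
    · exact Or.inr ⟨Or.inl hj, (hr j).2 hj⟩
    by_cases hl : C.light j = 1
    · have hd : robotStep u (C.light j) S (C.pos j) = (1, o) := by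
        have hidle : ¬ IsIdle (C.light j) S (C.pos j) := by
          rintro (e | e)
          · rw [hl] at e
            exact one_ne_zero e
          · exact h.center_ne (e ▸ h.pos_eq j hl)
        rw [robotStep, if_pos h.discRadius_lt, if_neg hidle, h.pos_eq j hl]
      refine Or.inl ⟨hj, hl, (hr j).1 hj _ _ hd ?_⟩
      rw [h.pos_eq j hl, dist_comm, hoc]
      linarith
    · have hl0 : C.light j = 0 := by omega
      have hd : robotStep u (C.light j) S (C.pos j) = (C.light j, C.pos j) := by
        rw [robotStep, if_pos h.discRadius_lt, if_pos (show IsIdle _ _ _ from Or.inl hl0)]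
      refine Or.inr ⟨Or.inr hl0, (hr j).1 hj _ _ hd ?_⟩
      rw [dist_self]
      linarith
  have hfar : ∀ j, C.pos j ≠ o ∧ 19 * u ≤ dist (C.pos j) o := by
    intro j
    have : 19 * u ≤ dist (C.pos j) o := by
      by_cases hj : C.pos j = c
      · rw [hj, dist_comm, hoc]
        exact hxge
      · linarith [hge j hj]
    refine ⟨fun e => ?_, this⟩
    rw [e, dist_self] at this
    linarith
  have hstay : ∀ j, C'.pos j ≠ o → C'.light j = C.light j ∧ C'.pos j = C.pos j := by
    intro j hj
    rcases hstep j with h' | h'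
    · exact absurd h'.2.2.2 hj
    · exact h'.2
  refine ⟨o, ⟨i, ?_⟩, ⟨j₀, ?_⟩, fun j hj => ?_, fun j hj => ?_, fun j hj => ?_, fun j k hj hk => ?_⟩
  · rcases hstep i with h' | h'
    · exact h'.2.2.2
    · rw [hlight] at h'
      exact absurd h'.1 (by simp [hact])
  · rcases hstep j₀ with h' | h'
    · exact absurd (h.pos_eq _ h'.2.1) hj₀
    · rw [h'.2.2, hj₀d]
  · rcases hstep j with h' | h'
    · exact h'.2.2.1
    · exact absurd (h'.2.2 ▸ hj) (hfar j).1
  · have hjo : C'.pos j ≠ o := by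
      intro e
      rw [e, dist_self] at hj
      linarith
    obtain ⟨e1, e2⟩ := hstay j hjo
    rw [e2] at hj
    rw [e1]
    by_contra hl
    have hl1 : C.light j = 1 := by omega
    rw [h.pos_eq j hl1, dist_comm, hoc] at hj
    linarith
  · rw [(hstay j hj).2]
    exact (hfar j).2
  · rw [(hstay j hj).2, (hstay k hk).2]
    have h1 := henc.dist_le (Set.mem_range_self j) (Set.mem_range_self k)
    linarith [h.discRadius_lt]

theorem round_eq (hδ : 40 * u ≤ δ) {active : Set (Fin n)} (h : ReadyState u c r C)
    (hr : RigidRound δ u active C C') (hact : ∀ i ∈ active, C.light i ≠ 1) : C' = C := by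
  have hu : 0 < u := by linarith [h.le_radius, h.radius_lt]
  refine Configuration.ext_of_forall fun j => ?_
  by_cases hj : j ∈ active
  · have hl0 : C.light j = 0 := by
      have := hact j hj
      omega
    have hd : robotStep u (C.light j) (Set.range C.pos) (C.pos j) = (C.light j, C.pos j) := by
      rw [robotStep, if_pos h.discRadius_lt, if_pos (show IsIdle _ _ _ from Or.inl hl0)]
    exact (hr j).1 hj _ _ hd (by rw [dist_self]; linarith)
  · exact (hr j).2 hj

/-- A marker will be created. -/
theorem exists_markerState (hδ : 40 * u ≤ δ) {active : ℕ → Set (Fin n)}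
    (hfair : Fair active) {C : ℕ → Configuration 2 n}
    (hr : ∀ t, RigidRound δ u (active t) (C t) (C (t + 1))) {t₀ : ℕ}
    (h : ReadyState u c r (C t₀)) : ∃ t ≥ t₀, ∃ o, MarkerState u o (C t) := by
  refine exists_goal_of_progress hfair (fun _ => 0) (Inv := ReadyState u c r)
    (Goal := fun A => ∃ o, MarkerState u o A) (fun A hA => ?_) h
  obtain ⟨i, hi⟩ := hA.exists_light
  refine ⟨i, ?_⟩
  rintro t rfl
  by_cases hact : ∃ j ∈ active t, (C t).light j = 1
  · obtain ⟨j, hj, hl⟩ := hact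
    exact Or.inl (hA.next hδ (hr t) hj hl)
  · push Not at hact
    have e := hA.round_eq hδ (hr t) hact
    exact Or.inr ⟨e ▸ hA, Or.inr ⟨e, fun hi' => hact i hi' hi⟩⟩

end ReadyState

/-! ### Moving to the center of the smallest enclosing disc -/

/-- The radius of the smallest enclosing disc is just below `u`, and the robots on the boundary of
this disc have color `0`. -/
structure CenterState {n : ℕ} (u : ℝ) (C : Configuration 2 n) : Prop where
  le_discRadius : 99 / 100 * u ≤ discRadius (Set.range C.pos)
  discRadius_lt : discRadius (Set.range C.pos) < u
  light_eq : ∀ i, dist (C.pos i) (discCenter (Set.range C.pos)) = discRadius (Set.range C.pos) →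
    C.light i = 0

/-- The robots which are neither at the center nor on the boundary of the smallest enclosing disc. -/
def innerRobots {n : ℕ} (C : Configuration 2 n) : Set (Fin n) :=
  {i | C.pos i ≠ discCenter (Set.range C.pos) ∧
    dist (C.pos i) (discCenter (Set.range C.pos)) ≠ discRadius (Set.range C.pos)}

namespace CenterState

variable {n : ℕ} [NeZero n] {δ u : ℝ} {C C' : Configuration 2 n}

theorem round (hu : 0 < u) (hδ : 40 * u ≤ δ) {active : Set (Fin n)} (h : CenterState u C)
    (hr : RigidRound δ u active C C') (i : Fin n) :
    (i ∈ active ∧ ¬ IsWaiting (Set.range C.pos) (C.pos i) ∧ C'.light i = 1 ∧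
        C'.pos i = discCenter (Set.range C.pos)) ∨
      ((i ∉ active ∨ IsWaiting (Set.range C.pos) (C.pos i)) ∧
        C'.light i = C.light i ∧ C'.pos i = C.pos i) := by
  by_cases hi : i ∈ active
  swap
  · exact Or.inr ⟨Or.inl hi, (hr i).2 hi⟩
  by_cases hw : IsWaiting (Set.range C.pos) (C.pos i)
  · have hd : robotStep u (C.light i) (Set.range C.pos) (C.pos i) = (C.light i, C.pos i) := by
      rw [robotStep, if_neg (not_lt.2 h.le_discRadius), if_pos h.discRadius_lt, if_pos hw]
    exact Or.inr ⟨Or.inr hw, (hr i).1 hi _ _ hd (by rw [dist_self]; linarith)⟩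
  · have hd : robotStep u (C.light i) (Set.range C.pos) (C.pos i) =
        (1, discCenter (Set.range C.pos)) := by
      rw [robotStep, if_neg (not_lt.2 h.le_discRadius), if_pos h.discRadius_lt, if_neg hw]
    have hle := (isEnclosing_range C.pos).1 _ ⟨i, rfl⟩
    exact Or.inl ⟨hi, hw, (hr i).1 hi _ _ hd (by linarith [h.discRadius_lt])⟩

/-- Boundary robots wait while an inner robot exists, and the boundary points determine the disc by
`IsEnclosing.of_boundary`. -/
theorem next_of_inner (hu : 0 < u) (hδ : 40 * u ≤ δ) {active : Set (Fin n)}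
    (h : CenterState u C) (hr : RigidRound δ u active C C') (hin : (innerRobots C).Nonempty) :
    CenterState u C' ∧ discCenter (Set.range C'.pos) = discCenter (Set.range C.pos) ∧
      discRadius (Set.range C'.pos) = discRadius (Set.range C.pos) := by
  have henc := isEnclosing_range C.pos
  have hstep := h.round hu hδ hr
  set c := discCenter (Set.range C.pos) with hc
  set R := discRadius (Set.range C.pos) with hR
  have hR0 : 0 < R := by linarith [h.le_discRadius]
  obtain ⟨j, hj1, hj2⟩ := hin
  have hwait : ∀ i, dist (C.pos i) c = R → IsWaiting (Set.range C.pos) (C.pos i) :=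
    fun i hi => Or.inr ⟨hi, _, ⟨j, rfl⟩, hj1, hj2⟩
  have hbd : ∀ i, dist (C.pos i) c = R → C'.pos i = C.pos i := by
    intro i hi
    rcases hstep i with h' | h'
    · exact absurd (hwait i hi) h'.2.1
    · exact h'.2.2
  have henc' : IsEnclosing (Set.range C'.pos) c R := by
    refine henc.of_boundary (Set.range_nonempty _) (Set.finite_range _) ?_ ?_
    · rintro _ ⟨i, rfl⟩
      rcases hstep i with h' | h'
      · rw [h'.2.2.2, dist_self]
        exact hR0.le
      · rw [h'.2.2]
        exact henc.1 _ ⟨i, rfl⟩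
    · rintro _ ⟨i, rfl⟩ hi
      exact ⟨i, hbd i hi⟩
  have hne := Set.range_nonempty C'.pos
  refine ⟨⟨?_, ?_, fun i hi => ?_⟩, henc'.center_eq hne, henc'.radius_eq hne⟩
  · rw [henc'.radius_eq hne]
    exact h.le_discRadius
  · rw [henc'.radius_eq hne]
    exact h.discRadius_lt
  · rw [henc'.radius_eq hne, henc'.center_eq hne] at hi
    rcases hstep i with h' | h'
    · rw [h'.2.2.2, dist_self] at hi
      exact absurd hi hR0.ne
    · rw [h'.2.1]
      exact h.light_eq i (h'.2.2 ▸ hi)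

/-- All robots outside `c` are on the circle with color 0, so every robot of color 1 is at `c` after
the round. The outcome depends only on the radius of the new disc. -/
theorem next_of_no_inner (hu : 0 < u) (hδ : 40 * u ≤ δ) {active : Set (Fin n)}
    (h : CenterState u C) (hr : RigidRound δ u active C C') (hin : innerRobots C = ∅)
    {i : Fin n} (hact : i ∈ active) (hi : C.pos i ≠ discCenter (Set.range C.pos)) :
    (IsGathered C' ∨ ∃ c r, ReadyState u c r C') ∨ CenterState u C' := by
  have henc := isEnclosing_range C.pos
  have hstep := h.round hu hδ hr
  have hRu := h.discRadius_lt
  have huR := h.le_discRadius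
  have hlight := h.light_eq
  set c := discCenter (Set.range C.pos) with hc
  set R := discRadius (Set.range C.pos) with hR
  have hR0 : 0 < R := by linarith
  have hcirc : ∀ j, C.pos j ≠ c → dist (C.pos j) c = R := by
    intro j hj
    by_contra hne
    exact (Set.eq_empty_iff_forall_notMem.1 hin j) ⟨hj, hne⟩
  have hwait : ∀ j, IsWaiting (Set.range C.pos) (C.pos j) → C.pos j = c := by
    rintro j (e | ⟨_, _, ⟨l, rfl⟩, hl, hl'⟩)
    · exact e
    · exact absurd (hcirc l hl) hl'
  have hcirc' : ∀ j, C'.pos j ≠ c → C'.light j = 0 ∧ dist (C'.pos j) c = R := by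
    intro j hj
    rcases hstep j with h' | h'
    · exact absurd h'.2.2.2 hj
    · rw [h'.2.2] at hj
      rw [h'.2.1, h'.2.2]
      exact ⟨hlight j (hcirc j hj), hcirc j hj⟩
  by_cases hg : ∀ j, C'.pos j = c
  · exact Or.inl (Or.inl ⟨c, hg⟩)
  push Not at hg
  have henc' := isEnclosing_range C'.pos
  have hin' : ∀ p ∈ Set.range C'.pos, dist p c ≤ R := by
    rintro _ ⟨j, rfl⟩
    by_cases hj : C'.pos j = c
    · rw [hj, dist_self]
      exact hR0.le
    · exact (hcirc' j hj).2.le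
  have hRR : discRadius (Set.range C'.pos) ≤ R := henc'.2 c R hin'
  by_cases hlt : discRadius (Set.range C'.pos) < 99 / 100 * u
  · refine Or.inl (Or.inr ⟨c, R, hlt, huR, hRu, ⟨i, ?_⟩, fun j hj => ?_, fun j hj => (hcirc' j hj).2,
      hg⟩)
    · rcases hstep i with h' | h'
      · exact h'.2.2.1
      · exact h'.1.elim (fun h => absurd hact h) fun h => absurd (hwait i h) hi
    · by_contra hne
      rw [(hcirc' j hne).1] at hj
      exact zero_ne_one hj
  · refine Or.inr ⟨not_lt.1 hlt, hRR.trans_lt hRu, fun j hj => ?_⟩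
    by_cases hjc : C'.pos j = c
    -- The old center cannot lie on the new boundary: with new radius `R'` this would give `3 * R' ^
    -- 2 ≤ 2 * R ^ 2`, impossible when both radii are in `[99/100 * u, u)`.
    · exfalso
      rw [hjc, dist_comm] at hj
      have h1 := henc'.dist_sq_le (Set.range_nonempty _) hin'
      rw [hj] at h1
      have h2 := not_lt.1 hlt
      nlinarith
    · exact (hcirc' j hjc).1

/-- A measure of the progress of the robots to the center of the smallest enclosing disc. -/
noncomputable def measure (C : Configuration 2 n) : ℕ :=
  (n + 1) * {i | C.light i = 0}.ncard + (innerRobots C).ncard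

/-- Robots in a disc of radius just below `u` gather, or some of them get the color `1` and are
able to create a marker. -/
theorem exists_ready (hu : 0 < u) (hδ : 40 * u ≤ δ) {active : ℕ → Set (Fin n)}
    (hfair : Fair active) {C : ℕ → Configuration 2 n}
    (hr : ∀ t, RigidRound δ u (active t) (C t) (C (t + 1))) {t₀ : ℕ} (h : CenterState u (C t₀)) :
    ∃ t ≥ t₀, IsGathered (C t) ∨ ∃ c r, ReadyState u c r (C t) := by
  refine exists_goal_of_progress hfair measure (Inv := CenterState u)
    (Goal := fun A => IsGathered A ∨ ∃ c r, ReadyState u c r A) (fun A hA => ?_) h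
  have hR0 : 0 < discRadius (Set.range A.pos) := by linarith [hA.le_discRadius]
  by_cases hin : (innerRobots A).Nonempty
  · obtain ⟨i, hi⟩ := hin
    refine ⟨i, ?_⟩
    rintro t rfl
    obtain ⟨h1, h2, h3⟩ := hA.next_of_inner hu hδ (hr t) ⟨i, hi⟩
    have hstep := hA.round hu hδ (hr t)
    refine Or.inr ⟨h1, ?_⟩
    by_cases hmove : ∃ j ∈ active t, ¬ IsWaiting (Set.range (C t).pos) ((C t).pos j)
    · obtain ⟨j, hj, hw⟩ := hmove
      left
      refine add_lt_add_of_le_of_lt (Nat.mul_le_mul_left _ (Set.ncard_le_ncard (fun l hl => ?_)))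
        (Set.ncard_lt_ncard ⟨fun l hl => ?_, fun hsub => ?_⟩ (Set.toFinite _))
      · rcases hstep l with h' | h'
        · have hl' : (C (t + 1)).light l = 0 := hl
          rw [h'.2.2.1] at hl'
          exact absurd hl' one_ne_zero
        · exact h'.2.1.symm.trans hl
      · rcases hstep l with h' | h'
        · exact absurd (h'.2.2.2.trans h2.symm) hl.1
        · have hl' := hl
          rw [innerRobots, Set.mem_ofPred_eq, h2, h3, h'.2.2] at hl'
          exact hl'
      · have hjin : j ∈ innerRobots (C t) :=
          ⟨fun e => hw (Or.inl e), fun e => hw (Or.inr ⟨e, _, ⟨i, rfl⟩, hi.1, hi.2⟩)⟩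
        rcases hstep j with h' | h'
        · exact (hsub hjin).1 (h'.2.2.2.trans h2.symm)
        · exact h'.1.elim (fun h => h hj) fun h => hw h
    · push Not at hmove
      right
      refine ⟨Configuration.ext_of_forall fun j => ?_, fun hact => ?_⟩
      · rcases hstep j with h' | h'
        · exact absurd (hmove j h'.1) h'.2.1
        · exact h'.2
      · rcases hmove i hact with e | e
        · exact hi.1 e
        · exact hi.2 e.1
  · have hin' := Set.not_nonempty_iff_eq_empty.1 hin
    obtain ⟨_, ⟨i, rfl⟩, hi⟩ := (isEnclosing_range A.pos).exists_dist_eq (Set.range_nonempty _)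
      (Set.finite_range _)
    have hic : A.pos i ≠ discCenter (Set.range A.pos) := by
      intro e
      rw [e, dist_self] at hi
      exact hR0.ne hi
    refine ⟨i, ?_⟩
    rintro t rfl
    have hstep := hA.round hu hδ (hr t)
    by_cases hmove : ∃ j ∈ active t, (C t).pos j ≠ discCenter (Set.range (C t).pos)
    · obtain ⟨j, hj, hjc⟩ := hmove
      rcases hA.next_of_no_inner hu hδ (hr t) hin' hj hjc with hg | hg
      · exact Or.inl hg
      refine Or.inr ⟨hg, Or.inl ?_⟩
      have hlt : {l | (C (t + 1)).light l = 0}.ncard < {l | (C t).light l = 0}.ncard := by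
        refine Set.ncard_lt_ncard ⟨fun l hl => ?_, fun hsub => ?_⟩ (Set.toFinite _)
        · rcases hstep l with h' | h'
          · have hl' : (C (t + 1)).light l = 0 := hl
            rw [h'.2.2.1] at hl'
            exact absurd hl' one_ne_zero
          · exact h'.2.1.symm.trans hl
        · have hjR : dist ((C t).pos j) (discCenter (Set.range (C t).pos)) =
              discRadius (Set.range (C t).pos) := by
            by_contra hne
            exact hin ⟨j, hjc, hne⟩
          have h0 : (C (t + 1)).light j = 0 := hsub (hA.light_eq j hjR)
          rcases hstep j with h' | h'
          · rw [h'.2.2.1] at h0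
            exact one_ne_zero h0
          · rcases h'.1 with h | h | h
            · exact h hj
            · exact hjc h
            · obtain ⟨_, _, ⟨l, rfl⟩, hl⟩ := h
              exact hin ⟨l, hl⟩
      -- The new disc may turn up to `n` robots into inner ones; the weight `n + 1` on color 0
      -- outweighs this.
      have hle : (innerRobots (C (t + 1))).ncard ≤ n := by
        have := Set.ncard_le_card (innerRobots (C (t + 1)))
        rwa [Nat.card_fin] at this
      unfold measure
      nlinarith
    · push Not at hmove
      have e : C (t + 1) = C t := by
        refine Configuration.ext_of_forall fun j => ?_
        rcases hstep j with h' | h'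
        · exact absurd (Or.inl (hmove j h'.1)) h'.2.1
        · exact h'.2
      exact Or.inr ⟨e ▸ hA, Or.inr ⟨e, fun hact => hic (hmove i hact)⟩⟩

end CenterState

/-! ### Contraction -/

section Contract

variable {u x : ℝ} {S : Set ℂ} {p q : ℂ}

theorem contract_of_le (h : dist p (discCenter S) ≤ discRadius S - u / 400) :
    contract u S x p = p :=
  if_pos h

theorem dist_contract_center (hu : 0 < u) (hR : u ≤ discRadius S) (hx : x ≤ 1)
    (h : discRadius S - u / 400 < dist p (discCenter S)) :
    dist (contract u S x p) (discCenter S) = dist p (discCenter S) - x * (u / 100) := by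
  have hd : 0 < dist p (discCenter S) := by linarith
  rw [contract, if_neg (not_le.2 h), dist_lineMap_right, Real.norm_of_nonneg, sub_mul, one_mul,
    div_mul_cancel₀ _ hd.ne']
  rw [sub_nonneg, div_le_one hd]
  nlinarith

theorem dist_contract_le (hu : 0 < u) (hx0 : 0 ≤ x) (hx : x ≤ 1) :
    dist p (contract u S x p) ≤ u / 100 := by
  by_cases h : dist p (discCenter S) ≤ discRadius S - u / 400
  · rw [contract_of_le h, dist_self]
    positivity
  · by_cases hd : dist p (discCenter S) = 0
    · rw [contract, if_neg h, dist_left_lineMap, hd, mul_zero]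
      positivity
    · rw [contract, if_neg h, dist_left_lineMap, Real.norm_of_nonneg (by positivity),
        div_mul_cancel₀ _ hd]
      nlinarith

theorem exists_contract_eq (u : ℝ) (S : Set ℂ) (p : ℂ) :
    ∃ v : ℂ, ∀ x : ℝ, contract u S x p = p + x * v := by
  by_cases h : dist p (discCenter S) ≤ discRadius S - u / 400
  · exact ⟨0, fun x => by rw [contract_of_le h]; simp⟩
  · refine ⟨((u / 100 / dist p (discCenter S) : ℝ) : ℂ) * (discCenter S - p), fun x => ?_⟩
    rw [contract, if_neg h, AffineMap.lineMap_apply, vsub_eq_sub, vadd_eq_add, Complex.real_smul]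
    push_cast
    ring

/-- The squared equation is polynomial in `x` with constant term `dist p q ^ 2 - r ^ 2`, which is
nonzero for `r ≥ 0`. -/
theorem finite_dist_eq {r : ℝ} (hpq : dist p q ≠ r) (v w : ℂ) :
    {x : ℝ | dist (p + x * v) (q + x * w) = r}.Finite := by
  by_cases hr : 0 ≤ r
  swap
  · convert Set.finite_empty
    ext x
    simp only [Set.mem_ofPred_eq, Set.mem_empty_iff_false, iff_false]
    intro h
    exact hr (h ▸ dist_nonneg)
  set P : Polynomial ℝ := Polynomial.C (Complex.normSq (v - w)) * Polynomial.X ^ 2 +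
    Polynomial.C (2 * ((p - q).re * (v - w).re + (p - q).im * (v - w).im)) * Polynomial.X +
    Polynomial.C (dist p q ^ 2 - r ^ 2) with hP
  have hP0 : P ≠ 0 := by
    intro h
    have h0 : P.eval 0 = 0 := by rw [h, Polynomial.eval_zero]
    simp only [hP, Polynomial.eval_add, Polynomial.eval_mul, Polynomial.eval_C,
      Polynomial.eval_pow, Polynomial.eval_X] at h0
    apply hpq
    rw [← abs_of_nonneg hr, ← abs_of_nonneg (dist_nonneg (x := p) (y := q)), ← sq_eq_sq_iff_abs_eq_abs]
    linarith
  refine (Polynomial.finite_setOfPred_isRoot hP0).subset fun x hx => ?_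
  have hx' : dist (p + x * v) (q + x * w) ^ 2 = r ^ 2 := by rw [hx]
  rw [Set.mem_ofPred_eq, Polynomial.IsRoot.def]
  simp only [hP, Polynomial.eval_add, Polynomial.eval_mul, Polynomial.eval_C,
    Polynomial.eval_pow, Polynomial.eval_X]
  rw [← hx']
  simp only [Complex.dist_eq, ← Complex.normSq_eq_norm_sq, Complex.normSq_apply]
  simp
  ring

/-- Each pair of points excludes finitely many factors, and `[1/2, 1]` is infinite. -/
theorem genericFactor_mem (hS : S.Finite) (h : ∀ p ∈ S, ∀ q ∈ S, dist p q ≠ 20 * u) :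
    genericFactor u S ∈ genericFactors u S := by
  have hfin : (⋃ p ∈ S, ⋃ q ∈ S, ({x : ℝ | dist (contract u S x p) (contract u S x q) = 20 * u} ∪
      {x : ℝ | dist (contract u S x p) q = 20 * u})).Finite := by
    refine hS.biUnion fun p hp => hS.biUnion fun q hq => ?_
    obtain ⟨v, hv⟩ := exists_contract_eq u S p
    obtain ⟨w, hw⟩ := exists_contract_eq u S q
    simp only [hv, hw]
    refine (finite_dist_eq (h p hp q hq) v w).union ?_
    simpa using finite_dist_eq (h p hp q hq) v 0
  obtain ⟨x, hx, hx'⟩ :=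
    ((Set.Icc_infinite (by norm_num : (1 / 2 : ℝ) < 1)).sdiff hfin).nonempty
  refine Classical.epsilon_spec (p := fun x => x ∈ genericFactors u S)
    ⟨x, hx.1, hx.2, fun p hp q hq => ⟨fun e => hx' ?_, fun e => hx' ?_⟩⟩
  · exact Set.mem_biUnion hp (Set.mem_biUnion hq (Or.inl e))
  · exact Set.mem_biUnion hp (Set.mem_biUnion hq (Or.inr e))

end Contract

/-- The robots do not fit into a small disc, they all have color `0`, and no point can be mistaken for
a marker. -/
structure ContractState {n : ℕ} (u : ℝ) (C : Configuration 2 n) : Prop where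
  light_eq : ∀ i, C.light i = 0
  dist_ne : ∀ i j, dist (C.pos i) (C.pos j) ≠ 20 * u
  le_discRadius : 99 / 100 * u ≤ discRadius (Set.range C.pos)

namespace ContractState

variable {n : ℕ} {δ u : ℝ} {C C' : Configuration 2 n}

theorem genericFactor_mem (h : ContractState u C) :
    genericFactor u (Set.range C.pos) ∈ genericFactors u (Set.range C.pos) := by
  refine RobotsWithLights.genericFactor_mem (Set.finite_range _) ?_
  rintro _ ⟨i, rfl⟩ _ ⟨j, rfl⟩
  exact h.dist_ne i j

theorem round (hu : 0 < u) (hδ : 40 * u ≤ δ) {active : Set (Fin n)} (h : ContractState u C)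
    (hR : u ≤ discRadius (Set.range C.pos)) (hr : RigidRound δ u active C C') (i : Fin n) :
    C'.light i = C.light i ∧
      (i ∈ active → C'.pos i =
        contract u (Set.range C.pos) (genericFactor u (Set.range C.pos)) (C.pos i)) ∧
      (i ∉ active → C'.pos i = C.pos i) := by
  by_cases hi : i ∈ active
  · have hm : ¬ ∃ o, IsMarker u (Set.range C.pos) o := by
      rintro ⟨_, ⟨j, rfl⟩, ⟨_, ⟨k, rfl⟩, hk⟩, -⟩
      exact h.dist_ne k j hk
    have hd : robotStep u (C.light i) (Set.range C.pos) (C.pos i) = (C.light i,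
        contract u (Set.range C.pos) (genericFactor u (Set.range C.pos)) (C.pos i)) := by
      rw [robotStep, if_neg (by linarith), if_neg (by linarith), if_neg hm]
    obtain ⟨hx, hx', -⟩ := h.genericFactor_mem
    obtain ⟨h1, h2⟩ := (hr i).1 hi _ _ hd
      ((dist_contract_le hu (by linarith) hx').trans (by linarith))
    exact ⟨h1, fun _ => h2, fun h => absurd hi h⟩
  · obtain ⟨h1, h2⟩ := (hr i).2 hi
    exact ⟨h1, fun h => absurd h hi, fun _ => h2⟩

variable [NeZero n]

/-- If a robot moves, it was near the boundary of the disc and leaves it. -/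
theorem pos_cases (hu : 0 < u) (hδ : 40 * u ≤ δ) {active : Set (Fin n)} (h : ContractState u C)
    (hR : u ≤ discRadius (Set.range C.pos)) (hr : RigidRound δ u active C C') (i : Fin n) :
    C'.pos i = C.pos i ∨
      (discRadius (Set.range C.pos) - u / 400 < dist (C.pos i) (discCenter (Set.range C.pos)) ∧
        dist (C'.pos i) (discCenter (Set.range C.pos)) ≤ discRadius (Set.range C.pos) - u / 200 ∧
        C'.pos i =
          contract u (Set.range C.pos) (genericFactor u (Set.range C.pos)) (C.pos i)) := by
  obtain ⟨-, h1, h2⟩ := h.round hu hδ hR hr i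
  by_cases hi : i ∈ active
  · rcases le_or_gt (dist (C.pos i) (discCenter (Set.range C.pos)))
      (discRadius (Set.range C.pos) - u / 400) with hle | hlt
    · exact Or.inl ((h1 hi).trans (contract_of_le hle))
    · obtain ⟨hx, hx', -⟩ := h.genericFactor_mem
      refine Or.inr ⟨hlt, ?_, h1 hi⟩
      rw [h1 hi, dist_contract_center hu hR hx' hlt]
      have := (isEnclosing_range C.pos).1 _ ⟨i, rfl⟩
      nlinarith
  · exact Or.inl (h2 hi)

theorem forall_dist_le (hu : 0 < u) (hδ : 40 * u ≤ δ) {active : Set (Fin n)}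
    (h : ContractState u C) (hR : u ≤ discRadius (Set.range C.pos))
    (hr : RigidRound δ u active C C') :
    ∀ p ∈ Set.range C'.pos, dist p (discCenter (Set.range C.pos)) ≤ discRadius (Set.range C.pos) := by
  rintro _ ⟨i, rfl⟩
  rcases h.pos_cases hu hδ hR hr i with e | e
  · rw [e]
    exact (isEnclosing_range C.pos).1 _ ⟨i, rfl⟩
  · linarith [e.2.1]

/-- The generic factor covers pairs in which both robots move and pairs in which only one does.
Steps of at most `u / 100` from a radius of at least `u` cannot skip the window above `99/100 * u`.
-/
theorem next (hu : 0 < u) (hδ : 40 * u ≤ δ) {active : Set (Fin n)} (h : ContractState u C)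
    (hR : u ≤ discRadius (Set.range C.pos)) (hr : RigidRound δ u active C C') :
    ContractState u C' := by
  obtain ⟨hx, hx', hgen⟩ := h.genericFactor_mem
  refine ⟨fun i => ?_, fun i j => ?_, ?_⟩
  · rw [(h.round hu hδ hR hr i).1, h.light_eq]
  · rcases h.pos_cases hu hδ hR hr i with ei | ei <;> rcases h.pos_cases hu hδ hR hr j with ej | ej
    · rw [ei, ej]
      exact h.dist_ne i j
    · rw [ei, ej.2.2, dist_comm]
      exact (hgen _ ⟨j, rfl⟩ _ ⟨i, rfl⟩).2
    · rw [ei.2.2, ej]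
      exact (hgen _ ⟨i, rfl⟩ _ ⟨j, rfl⟩).2
    · rw [ei.2.2, ej.2.2]
      exact (hgen _ ⟨i, rfl⟩ _ ⟨j, rfl⟩).1
  · have h1 := (isEnclosing_range C.pos).2 (discCenter (Set.range C'.pos))
      (discRadius (Set.range C'.pos) + u / 100) ?_
    · linarith
    rintro _ ⟨i, rfl⟩
    have h2 := (isEnclosing_range C'.pos).1 _ ⟨i, rfl⟩
    have h3 : dist (C.pos i) (C'.pos i) ≤ u / 100 := by
      rcases h.pos_cases hu hδ hR hr i with e | e
      · rw [e, dist_self]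
        positivity
      · rw [e.2.2]
        exact dist_contract_le hu (by linarith) hx'
    linarith [dist_triangle (C.pos i) (C'.pos i) (discCenter (Set.range C'.pos))]

/-- The robots contract until they fit into a disc of radius just below `u`. -/
theorem exists_centerState (hu : 0 < u) (hδ : 40 * u ≤ δ) {active : ℕ → Set (Fin n)}
    (hfair : Fair active) {C : ℕ → Configuration 2 n}
    (hr : ∀ t, RigidRound δ u (active t) (C t) (C (t + 1))) (h₀ : ContractState u (C 0)) :
    ∃ t, CenterState u (C t) := by
  by_contra! hno
  set c : ℕ → ℂ := fun t => discCenter (Set.range (C t).pos) with hc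
  set R : ℕ → ℝ := fun t => discRadius (Set.range (C t).pos) with hRdef
  have hle : ∀ t, ContractState u (C t) → u ≤ R t := by
    intro t ht
    by_contra! hlt
    exact hno t ⟨ht.le_discRadius, hlt, fun i _ => ht.light_eq i⟩
  have hinv : ∀ t, ContractState u (C t) := by
    intro t
    induction t with
    | zero => exact h₀
    | succ t ih => exact ih.next hu hδ (hle t ih) (hr t)
  have huR : ∀ t, u ≤ R t := fun t => hle t (hinv t)
  have hpos : ∀ t i, (C (t + 1)).pos i = (C t).pos i ∨
      (R t - u / 400 < dist ((C t).pos i) (c t) ∧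
        dist ((C (t + 1)).pos i) (c t) ≤ R t - u / 200 ∧ _) :=
    fun t i => (hinv t).pos_cases hu hδ (huR t) (hr t) i
  have hball := fun t => (hinv t).forall_dist_le hu hδ (huR t) (hr t)
  have hanti : Antitone R :=
    antitone_nat_of_succ_le fun t => (isEnclosing_range (C (t + 1)).pos).2 _ _ (hball t)
  have hcc : ∀ t, dist (c (t + 1)) (c t) ^ 2 ≤ 2 * (R t ^ 2 - R (t + 1) ^ 2) := fun t =>
    (isEnclosing_range (C (t + 1)).pos).dist_sq_le (Set.range_nonempty _) (hball t)
  have hbdd : BddBelow (Set.range R) := ⟨u, by rintro _ ⟨t, rfl⟩; exact huR t⟩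
  set L := ⨅ t, R t with hL
  have hLle : ∀ t, L ≤ R t := fun t => ciInf_le hbdd t
  have hL0 : 0 ≤ L := hu.le.trans (le_ciInf huR)
  have hn : (0 : ℝ) < n + 1 := by positivity
  set ε : ℝ := u / (1600 * (n + 1)) with hε
  have hε0 : 0 < ε := by positivity
  have hnε : n * ε ≤ u / 1600 := by
    rw [hε, mul_div_assoc', div_le_div_iff₀ (by positivity) (by positivity)]
    nlinarith
  have hlim := tendsto_atTop_ciInf hanti hbdd
  -- The second bound makes the squared drift of the center per round at most `2 * (R T ^ 2 - L ^ 2)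
  -- < ε ^ 2`.
  obtain ⟨T, hT1, hT2⟩ : ∃ T, R T < L + u / 1600 ∧ R T ^ 2 < L ^ 2 + ε ^ 2 / 2 :=
    ((hlim.eventually_lt_const (by linarith)).and
      ((hlim.pow 2).eventually_lt_const (by linarith [pow_pos hε0 2]))).exists
  have hdrift : ∀ t ≥ T, dist (c (t + 1)) (c t) ≤ ε := by
    intro t ht
    refine (pow_le_pow_iff_left₀ dist_nonneg hε0.le two_ne_zero).1 ?_
    have h1 := hcc t
    have h2 : R t ^ 2 ≤ R T ^ 2 := pow_le_pow_left₀ (hu.le.trans (huR t)) (hanti ht) 2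
    have h3 : L ^ 2 ≤ R (t + 1) ^ 2 := pow_le_pow_left₀ hL0 (hLle _) 2
    linarith
  -- `M t` collects the robots that have moved between `T` and `t`.
  set M : ℕ → Set (Fin n) := fun t => {i | ∃ τ, T ≤ τ ∧ τ < t ∧ (C (τ + 1)).pos i ≠ (C τ).pos i}
    with hM
  have hMmono : Monotone M := by
    rintro s t hst i ⟨τ, h1, h2, h3⟩
    exact ⟨τ, h1, h2.trans_le hst, h3⟩
  have hMn : ∀ t, ((M t).ncard : ℝ) * ε ≤ n * ε := by
    intro t
    have h1 := Set.ncard_le_card (M t)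
    rw [Nat.card_fin] at h1
    have : ((M t).ncard : ℝ) ≤ n := by exact_mod_cast h1
    gcongr
  -- A robot that has moved is `u / 200` inside, while moving again requires depth below `u / 400`.
  -- The slack `u / 400` exceeds the total loss: `u / 1600` in the radius and twice `n * ε ≤ u /
  -- 1600` from the drift.
  have hstill : ∀ t ≥ T, dist (c t) (c T) ≤ (M t).ncard * ε →
      (∀ i ∈ M t, dist ((C t).pos i) (c T) ≤ R T - u / 200 + n * ε) →
      ∀ i ∈ M t, (C (t + 1)).pos i = (C t).pos i := by
    intro t _ h1 h2 i hi
    refine (hpos t i).resolve_right fun h3 => ?_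
    have h4 := dist_triangle_right ((C t).pos i) (c t) (c T)
    linarith [h2 i hi, hMn t, hLle t, h3.1]
  have hmain : ∀ t ≥ T, dist (c t) (c T) ≤ (M t).ncard * ε ∧
      ∀ i ∈ M t, dist ((C t).pos i) (c T) ≤ R T - u / 200 + n * ε := by
    intro t ht
    induction t, ht using Nat.le_induction with
    | base =>
      refine ⟨by rw [dist_self]; positivity, ?_⟩
      rintro i ⟨τ, h1, h2, -⟩
      omega
    | succ t ht ih =>
      have hst := hstill t ht ih.1 ih.2
      have hsub : M t ⊆ M (t + 1) := hMmono (Nat.le_succ t)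
      constructor
      · by_cases hmv : ∃ i, (C (t + 1)).pos i ≠ (C t).pos i
        · obtain ⟨i, hi⟩ := hmv
          -- The center drifts only when some robot moves, and that robot is new to `M`; so at most
          -- `n` rounds contribute drift.
          have hlt : (M t).ncard < (M (t + 1)).ncard :=
            Set.ncard_lt_ncard ⟨hsub, fun h => hi (hst i (h ⟨t, ht, Nat.lt_succ_self t, hi⟩))⟩
              (Set.toFinite _)
          have hlt' : ((M t).ncard : ℝ) + 1 ≤ (M (t + 1)).ncard := by exact_mod_cast hlt
          have h1 := dist_triangle (c (t + 1)) (c t) (c T)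
          have h2 := hdrift t ht
          nlinarith [ih.1]
        · push Not at hmv
          have e : c (t + 1) = c t := by
            simp only [hc, show (C (t + 1)).pos = (C t).pos from funext hmv]
          rw [e]
          refine ih.1.trans ?_
          have := Set.ncard_le_ncard hsub
          gcongr
      · rintro i ⟨τ, h1, h2, h3⟩
        by_cases hi : i ∈ M t
        · rw [hst i hi]
          exact ih.2 i hi
        · have hτ : τ = t := by
            by_contra hne
            exact hi ⟨τ, h1, by omega, h3⟩
          subst hτ
          have h4 := (hpos τ i).resolve_left h3
          have h5 := dist_triangle ((C (τ + 1)).pos i) (c τ) (c T)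
          linarith [h4.2.1, hanti ht, ih.1, hMn τ]
  obtain ⟨N, hN⟩ := WellFoundedGT.monotone_chain_condition (⟨M, hMmono⟩ : ℕ →o Set (Fin n))
  set T' := max N T with hT'
  have hfix : ∀ t ≥ T', ∀ i, (C (t + 1)).pos i = (C t).pos i := by
    intro t ht i
    have htT : T ≤ t := (le_max_right N T).trans ht
    have htN : N ≤ t := (le_max_left N T).trans ht
    by_contra hne
    have h1 : i ∈ M (t + 1) := ⟨t, htT, Nat.lt_succ_self t, hne⟩
    have h2 : M (t + 1) = M t := (hN (t + 1) (by omega)).symm.trans (hN t htN)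
    rw [h2] at h1
    exact hne (hstill t htT (hmain t htT).1 (hmain t htT).2 i h1)
  have hconst : ∀ t ≥ T', (C t).pos = (C T').pos := by
    intro t ht
    induction t, ht using Nat.le_induction with
    | base => rfl
    | succ t ht ih => exact (funext (hfix t ht)).trans ih
  -- With all positions frozen, a robot on the boundary is still activated eventually and must then
  -- step inwards, a contradiction.
  obtain ⟨_, ⟨i, rfl⟩, hi⟩ := (isEnclosing_range (C T').pos).exists_dist_eq (Set.range_nonempty _)
    (Set.finite_range _)
  obtain ⟨t, ht, hact⟩ := hfair i T'
  have h1 := ((hinv t).round hu hδ (huR t) (hr t) i).2.1 hact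
  obtain ⟨hx, hx', -⟩ := (hinv t).genericFactor_mem
  rw [hfix t ht i] at h1
  rw [← hconst t ht] at hi
  have h2 := dist_contract_center (p := (C t).pos i) hu (huR t) hx' (by rw [hi]; linarith)
  rw [← h1] at h2
  nlinarith

end ContractState

end RobotsWithLights

/-! ### Choice of the unit `u` and composition of the phases -/

theorem theorem8 (δ D : ℝ) (hδ : 0 < δ) (hD : 0 < D) (hDδ : D ≤ 2 * δ) :
    ∃ 𝒜 : RobotsWithLights.Algorithm 2, ∀ n : ℕ, 2 ≤ n →
      ∀ C : ℕ → RobotsWithLights.Configuration 2 n,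
        RobotsWithLights.IsExecution 𝒜 δ C → (C 0).IsDistant D →
          RobotsWithLights.Gathers C := by
  open RobotsWithLights in
  -- The factor 80 turns `D ≤ 2 * δ` into `40 * u ≤ δ`, and keeps initial distances away from `20 *
  -- u` and, unless gathered, the initial radius at least `40 * u`.
  obtain ⟨u, rfl⟩ : ∃ u, D = 80 * u := ⟨D / 80, by ring⟩
  have hu : 0 < u := by linarith
  have hδu : 40 * u ≤ δ := by linarith
  refine ⟨gatheringAlgorithm δ u, fun n hn C ⟨hinit, active, F, hfair, _, hround⟩ hdist => ?_⟩
  have : NeZero n := ⟨by omega⟩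
  have hr : ∀ t, RigidRound δ u (active t) (C t) (C (t + 1)) :=
    fun t => (hround t).rigidRound hδ hu
  suffices h : ∃ t, IsGathered (C t) by
    obtain ⟨T, p, hp⟩ := h
    refine ⟨p, T, fun t ht => ?_⟩
    induction t, ht using Nat.le_induction with
    | base => exact hp
    | succ t _ ih => exact IsGathered.round hδ hu (hr t) ih
  by_cases hg : ∀ i, (C 0).pos i = (C 0).pos 0
  · exact ⟨0, _, hg⟩
  push Not at hg
  obtain ⟨i, hi⟩ := hg
  have h₀ : ContractState u (C 0) := by
    refine ⟨hinit, fun j k h => ?_, ?_⟩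
    · have hne : (C 0).pos j ≠ (C 0).pos k := by
        intro e
        rw [e, dist_self] at h
        linarith
      linarith [hdist j k hne]
    · have := (isEnclosing_range (C 0).pos).dist_le (Set.mem_range_self i) (Set.mem_range_self 0)
      linarith [hdist i 0 hi]
  obtain ⟨t₁, h₁⟩ := h₀.exists_centerState hu hδu hfair hr
  obtain ⟨t₂, -, h₂ | ⟨c, r, h₂⟩⟩ := h₁.exists_ready hu hδu hfair hr
  · exact ⟨t₂, h₂⟩
  obtain ⟨t₃, -, o, h₃⟩ := h₂.exists_markerState hδu hfair hr
  obtain ⟨t₄, -, h₄⟩ := h₃.exists_gathered hu hδu hfair hr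
  exact ⟨t₄, h₄⟩
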